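/- Let $\mathbb T$ be the unit circle and let $|\cdot|$ be normalized Lebesgue measure on $\mathbb T$. Let $\Lambda:(0,1]\to(0,\infty)$ be a majorant: a non-increasing, convex, differentiable function with $\Lambda(0^+)=+\infty$ such that $t\Lambda(t)$, given the value $0$ at $t=0$, is continuous, non-decreasing and concave on $[0,1]$, such that $t^{\alpha}\Lambda(t)$ is non-decreasing on $(0,1]$ for some $\alpha\in(0,1)$, and such that $\Lambda(t^2)\le C\Lambda(t)$ on $(0,1]$ for some constant $C$. Let $\mathcal B(\mathbb T)$ be the set of all open, half-open and closed arcs of $\mathbb T$, including single points, the empty set and $\mathbb T$. A premeasure is a function $\mu:\mathcal B(\mathbb T)\to\mathbb R$ with $\mu(\mathbb T)=0$, with $\mu(I\cup J)=\mu(I)+\mu(J)$ whenever $I$, $J$ and $I\cup J$ are arcs and $I\cap J=\emptyset$, and with $\mu(I_n)\to0$ for every decreasing sequence of arcs $I_n$ with $\bigcap_n I_n=\emptyset$. It is $\Lambda$-bounded if there is $C>0$ such that $\mu(I)\le C|I|\Lambda(|I|)$ for every arc $I$ (the right-hand side being $0$ if $|I|=0$); the infimum of such $C$ is denoted by $\|\mu\|_\Lambda^+$.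 A $\Lambda$-Carleson set is a non-empty closed set $F\subset\mathbb T$ with $|F|=0$ and $\sum_n|I_n|\Lambda(|I_n|)<\infty$, where $(I_n)$ are the component arcs of $\mathbb T\setminus F$. The $\Lambda$-singular part of a $\Lambda$-bounded premeasure $\mu$ is defined on $\Lambda$-Carleson sets by $\mu_s(F)=-\sum_n\mu(I_n)$. A $\Lambda$-bounded premeasure $\mu$ is called $\Lambda$-absolutely continuous if there is a sequence $(\mu_n)$ of $\Lambda$-bounded premeasures such that $\sup_n\|\mu+\mu_n\|_\Lambda^+<\infty$ and $\sup_{I\in\mathcal B(\mathbb T)}|(\mu+\mu_n)(I)|\to0$ as $n\to\infty$. **Theorem.** Let $\mu$ be a $\Lambda$-bounded premeasure. Then the series defining $\mu_s(F)$ converges absolutely for every $\Lambda$-Carleson set $F$, and $\mu$ is $\Lambda$-absolutely continuous if and only if $\mu_s(F)=0$ for every $\Lambda$-Carleson set $F$. -/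

import Mathlib

open Filter Topology MeasureTheory Set
open scoped ENNReal

noncomputable section

namespace LambdaPremeasure

/-- The unit circle, with `t` mod `1` standing for the point `e^{2πit}`. Its `volume` is the
Lebesgue measure normalized to total mass `1`. -/
abbrev Torus : Type := UnitAddCircle

/-- The normalized Lebesgue measure `|I|` of a subset of the circle, as a real number. -/
def len (I : Set Torus) : ℝ := volume.real I

/-- Majorants `Λ : (0, 1] → (0, ∞)`. Only the values on `(0, 1]` matter: `t * Λ t` vanishes at `0`
whatever the value `Λ 0` is, which is the convention used at `0` (and for arcs of length `0`). -/
structure IsMajorant (Λ : ℝ → ℝ) : Prop where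
  pos : ∀ t ∈ Ioc (0 : ℝ) 1, 0 < Λ t
  antitone : AntitoneOn Λ (Ioc 0 1)
  convex : ConvexOn ℝ (Ioc 0 1) Λ
  differentiable : DifferentiableOn ℝ Λ (Ioc 0 1)
  tendsto_top : Tendsto Λ (𝓝[>] 0) atTop
  mul_continuous : ContinuousOn (fun t => t * Λ t) (Icc 0 1)
  mul_monotone : MonotoneOn (fun t => t * Λ t) (Icc 0 1)
  mul_concave : ConcaveOn ℝ (Icc 0 1) (fun t => t * Λ t)
  mul_tendsto_zero : Tendsto (fun t => t * Λ t) (𝓝[>] 0) (𝓝 0)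
  rpow_mul_monotone : ∃ α ∈ Ioo (0 : ℝ) 1, MonotoneOn (fun t => t ^ α * Λ t) (Ioc 0 1)
  sq_le : ∃ C : ℝ, ∀ t ∈ Ioc (0 : ℝ) 1, Λ (t ^ 2) ≤ C * Λ t

/-- The arcs of the circle: images of closed, half-open and open intervals with endpoints
`a ≤ b ≤ a + 1`. The empty set (`Ioo a a`), the single points (`Icc a a`), the circle without a
point (`Ioo a (a + 1)`) and the whole circle (`Icc a (a + 1)`) are included. -/
def IsArc (I : Set Torus) : Prop :=
  ∃ a b : ℝ, a ≤ b ∧ b ≤ a + 1 ∧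
    (I = (fun t : ℝ => (t : Torus)) '' Icc a b ∨ I = (fun t : ℝ => (t : Torus)) '' Ico a b ∨
      I = (fun t : ℝ => (t : Torus)) '' Ioc a b ∨ I = (fun t : ℝ => (t : Torus)) '' Ioo a b)

/-- Premeasures: real functions on the arcs (values on sets that are not arcs are irrelevant and
never used) with total mass zero, additive, and continuous at the empty set. -/
structure IsPremeasure (μ : Set Torus → ℝ) : Prop where
  univ : μ Set.univ = 0
  union : ∀ I J, IsArc I → IsArc J → IsArc (I ∪ J) → I ∩ J = ∅ → μ (I ∪ J) = μ I + μ J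
  tendsto : ∀ I : ℕ → Set Torus, (∀ n, IsArc (I n)) → (∀ n, I (n + 1) ⊆ I n) → ⋂ n, I n = ∅ →
    Tendsto (fun n => μ (I n)) atTop (𝓝 0)

/-- The positive constants `C` with `μ(I) ≤ C |I| Λ(|I|)` for all arcs `I`. -/
def boundConstants (Λ : ℝ → ℝ) (μ : Set Torus → ℝ) : Set ℝ :=
  {C | 0 < C ∧ ∀ I, IsArc I → μ I ≤ C * (len I * Λ (len I))}

/-- `μ` is a `Λ`-bounded premeasure. -/
def IsBddPremeasure (Λ : ℝ → ℝ) (μ : Set Torus → ℝ) : Prop :=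
  IsPremeasure μ ∧ (boundConstants Λ μ).Nonempty

/-- The norm `‖μ‖_Λ^+`, used only for `Λ`-bounded premeasures. -/
def bddNorm (Λ : ℝ → ℝ) (μ : Set Torus → ℝ) : ℝ := sInf (boundConstants Λ μ)

/-- The component arcs of the complement of `F`. -/
def complArcs (F : Set Torus) : Set (Set Torus) :=
  {I | ∃ x ∈ Fᶜ, I = connectedComponentIn Fᶜ x}

/-- The `Λ`-entropy of `F`, as a (possibly infinite) sum of nonnegative terms. -/
def entropy (Λ : ℝ → ℝ) (F : Set Torus) : ℝ≥0∞ :=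
  ∑' I : complArcs F, ENNReal.ofReal (len I.1 * Λ (len I.1))

/-- `Λ`-Carleson sets. -/
structure IsCarlesonSet (Λ : ℝ → ℝ) (F : Set Torus) : Prop where
  closed : IsClosed F
  nonempty : F.Nonempty
  null : volume F = 0
  entropy_lt_top : entropy Λ F < ∞

/-- The `Λ`-singular part `μ_s(F) = -∑ μ(I_n)`, over the complementary arcs `I_n` of a
`Λ`-Carleson set `F`. -/
def singularPart (μ : Set Torus → ℝ) (F : Set Torus) : ℝ := -∑' I : complArcs F, μ I.1

/-- `Λ`-absolute continuity of `μ`. The supremum over all arcs is taken in `[0, ∞]`. -/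
def IsAbsCont (Λ : ℝ → ℝ) (μ : Set Torus → ℝ) : Prop :=
  ∃ ν : ℕ → Set Torus → ℝ, (∀ n, IsBddPremeasure Λ (ν n)) ∧
    BddAbove (range fun n => bddNorm Λ (μ + ν n)) ∧
    Tendsto (fun n => ⨆ I : {I : Set Torus // IsArc I}, ‖(μ + ν n) I.1‖ₑ) atTop (𝓝 0)

end LambdaPremeasure

end

/-! Write `f` for the distribution function of `μ` and `k t` for `t * Λ t`. Being `Λ`-bounded means
the one-sided estimate `f t - f s ≤ C * k (t - s)` for `s ≤ t ≤ s + 1`.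

Suppose the singular part vanishes. Fix `ε` and look for `f = G + h` with `-ε ≤ h ≤ 0`, `h v - h u ≤
2 * C * k (v - u)` and `G u - G v ≤ K * k (v - u)`, where `K` may depend on `ε`. The premeasure with
distribution function `-G` is then an admissible correction, since adding it to `μ` leaves `h`. Both
requirements on increments are difference constraints `h v - h u ≤ c u v`, with `c` the minimum of
two costs. As in shortest-path duality, the largest nonpositive solution is the infimum of the costs
of chains ending at `v`, and it is at least `-ε` unless some chain is cheaper
(`exists_decomposition_of_chain_cost`).

If chains cheaper than `-ε` existed for arbitrarily large `K`, their steps paid at rate `2 * C`,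
together with one closing interval, would be disjoint intervals in one period, of bounded entropy,
with missing length at most `C / K` and `f`-mass at least `ε`. As `k t / t` tends to infinity at
`0`, no length is lost in short intervals. A limit is then the family of complementary arcs of a
Carleson set with total mass at least `ε`, a contradiction (`exists_chain_cost_ge`).

Conversely, every `Λ`-bounded premeasure has nonnegative total mass on the complementary arcs of a
Carleson set (`tsum_complArcs_nonneg`), because the gaps between the long arcs can carry little
positive mass. Approximation makes the corresponding sum for `μ + ν n` at most any given positive
number; the sum for `ν n` is nonnegative, so that of `μ` is at most zero, hence zero. -/

noncomputable section

namespace LambdaPremeasure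

/-! ### Chains of steps on the line and their costs -/

/-- `ForwardChain c x y s`: there is a finite chain of forward steps of length at most `1` leading
from `x` to `y`, of total cost `s`. -/
inductive ForwardChain (c : ℝ → ℝ → ℝ) (x : ℝ) : ℝ → ℝ → Prop
  | nil : ForwardChain c x x 0
  | snoc {u v s : ℝ} : ForwardChain c x u s → u ≤ v → v ≤ u + 1 → ForwardChain c x v (s + c u v)

namespace ForwardChain

variable {c : ℝ → ℝ → ℝ} {x y s : ℝ}

theorem le (h : ForwardChain c x y s) : x ≤ y := by
  induction h with
  | nil => exact le_rfl
  | snoc _ huv _ ih => exact ih.trans huv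

theorem translate (h : ForwardChain c x y s) {p : ℝ} (hp : ∀ u v, c (u + p) (v + p) = c u v) :
    ForwardChain c (x + p) (y + p) s := by
  induction h with
  | nil => exact nil
  | @snoc u v s _ huv hvu ih =>
    have := ih.snoc (v := v + p) (by linarith) (by linarith)
    rwa [hp] at this

/-- Cutting a chain at a point `z` shortly before its end. -/
theorem truncate (h : ForwardChain c x y s) {f w : ℝ → ℝ}
    (hc : ∀ u v, u ≤ v → v ≤ u + 1 → f v - f u ≤ c u v)
    (hw : Monotone w) (hfw : ∀ u v, u ≤ v → v ≤ u + 1 → f v - f u ≤ w (v - u))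
    (hcw : ∀ u z v, u ≤ z → z ≤ v → v ≤ u + 1 → c u z ≤ c u v + (f z - f v) + w (v - z))
    {z : ℝ} (hzy : z ≤ y) (hyz : y ≤ z + 1) :
    ∃ x' s', ForwardChain c x' z s' ∧ s' ≤ s + (f z - f y) + w (y - z) := by
  induction h with
  | nil =>
    refine ⟨z, 0, nil, ?_⟩
    linarith [hfw z x hzy hyz]
  | @snoc u v s hch huv hvu ih =>
    -- If `z` precedes the last step, that step is dropped: it cost at least `f v - f u`. Otherwise
    -- only the last step is shortened.
    rcases le_total z u with hzu | huz
    · obtain ⟨x', s', h1, h2⟩ := ih hzu (by linarith)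
      refine ⟨x', s', h1, ?_⟩
      have := hw (show u - z ≤ v - z by linarith)
      linarith [hc u v huv hvu]
    · refine ⟨x, _, hch.snoc huz (by linarith), ?_⟩
      linarith [hcw u z v huz hzy hvu]

end ForwardChain

/-- The cheaper of the two ways of stepping from `u` to `v`. -/
def stepCost (k f : ℝ → ℝ) (C K u v : ℝ) : ℝ :=
  min (C * k (v - u)) (f v - f u + K * k (v - u))

/-- Only steps paid at rate `C` are recorded. On the others the increments of `f` telescope into `f
y - f x`, and `k t ≥ t * k 1` turns their cost `K * k` into a penalty on the length left uncovered.
-/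
theorem ForwardChain.exists_list {k f : ℝ → ℝ} {C K x y s : ℝ}
    (hlin : ∀ t ∈ Icc (0 : ℝ) 1, t * k 1 ≤ k t) (hK : 0 ≤ K)
    (h : ForwardChain (stepCost k f C K) x y s) :
    ∃ l : List (ℝ × ℝ), (∀ p ∈ l, x ≤ p.1 ∧ p.1 ≤ p.2 ∧ p.2 ≤ y ∧ p.2 ≤ p.1 + 1) ∧
      l.Pairwise (fun p q => q.2 ≤ p.1) ∧
      (l.map fun p => C * k (p.2 - p.1) - (f p.2 - f p.1)).sum + (f y - f x) +
        K * k 1 * (y - x - (l.map fun p => p.2 - p.1).sum) ≤ s := by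
  induction h with
  | nil => exact ⟨[], by simp⟩
  | @snoc u v s hch huv hvu ih =>
    obtain ⟨l, h1, h2, h3⟩ := ih
    have hxu := hch.le
    rcases min_choice (C * k (v - u)) (f v - f u + K * k (v - u)) with hm | hm
    · refine ⟨(u, v) :: l, ?_, ?_, ?_⟩
      · intro p hp
        rcases List.mem_cons.1 hp with rfl | hp
        · exact ⟨hxu, huv, le_rfl, hvu⟩
        · obtain ⟨p1, p2, p3, p4⟩ := h1 p hp
          exact ⟨p1, p2, p3.trans huv, p4⟩
      · exact List.pairwise_cons.2 ⟨fun q hq => (h1 q hq).2.2.1, h2⟩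
      · simp only [List.map_cons, List.sum_cons]
        rw [stepCost, hm]
        linarith
    · refine ⟨l, ?_, h2, ?_⟩
      · intro p hp
        obtain ⟨p1, p2, p3, p4⟩ := h1 p hp
        exact ⟨p1, p2, p3.trans huv, p4⟩
      · rw [stepCost, hm]
        have := mul_le_mul_of_nonneg_left (hlin (v - u) ⟨by linarith, by linarith⟩) hK
        linarith

theorem sub_le_of_periodic {k f : ℝ → ℝ} {C : ℝ} (hk : Monotone k) (hC : 0 ≤ C)
    (hf : Function.Periodic f 1)
    (hfk : ∀ s t, s ≤ t → t ≤ s + 1 → f t - f s ≤ C * k (t - s)) (s t : ℝ) :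
    f t - f s ≤ C * k 1 := by
  have h := hfk s (t - ⌊t - s⌋) (by linarith [Int.floor_le (t - s)])
    (by linarith [Int.lt_floor_add_one (t - s)])
  have h2 : f (t - ⌊t - s⌋) = f t := by simpa using hf.sub_int_mul_eq ⌊t - s⌋ (x := t)
  rw [h2] at h
  exact h.trans (mul_le_mul_of_nonneg_left (hk (by linarith [Int.lt_floor_add_one (t - s)])) hC)

/-- A chain that is too cheap gives a finite family of non-overlapping intervals, sorted by length,
that nearly fills a period. -/
theorem ForwardChain.exists_seq {k f : ℝ → ℝ} {C K x y s ε : ℝ}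
    (hkm : Monotone k) (hk0 : k 0 = 0)
    (hlin : ∀ t ∈ Icc (0 : ℝ) 1, t * k 1 ≤ k t) (hk1 : 0 < k 1)
    (hf : Function.Periodic f 1) (hC : 0 < C)
    (hfk : ∀ s t, s ≤ t → t ≤ s + 1 → f t - f s ≤ C * k (t - s)) (hK : C ≤ K) (hε : 0 < ε)
    (h : ForwardChain (stepCost k f (2 * C) K) x y s) (hs : s < -ε) :
    ∃ (p : ℕ → ℝ × ℝ) (L : ℕ), (∀ n, x ≤ (p n).1 ∧ (p n).1 ≤ (p n).2 ∧ (p n).2 ≤ x + 1) ∧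
      (∀ m n, m ≠ n → (p m).2 ≤ (p n).1 ∨ (p n).2 ≤ (p m).1) ∧
      (∀ m n, m ≤ n → (p n).2 - (p n).1 ≤ (p m).2 - (p m).1) ∧
      (∀ n, L ≤ n → (p n).2 = (p n).1) ∧
      (∑ n ∈ Finset.range L, k ((p n).2 - (p n).1) ≤ 2 * k 1) ∧
      (K * (1 - ∑ n ∈ Finset.range L, ((p n).2 - (p n).1)) ≤ C) ∧
      (∑ n ∈ Finset.range L, (C * k ((p n).2 - (p n).1) - (f (p n).2 - f (p n).1)) ≤
        -ε + C * k ((p 0).2 - (p 0).1)) := by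
  have hosc := sub_le_of_periodic hkm hC.le hf hfk
  obtain ⟨l, hl, hlp, hls⟩ := h.exists_list hlin (hC.le.trans hK)
  have hxy := h.le
  have hknn : ∀ t, 0 ≤ t → 0 ≤ k t := fun t ht => hk0 ▸ hkm ht
  -- lower bounds for the sums over the list
  have hA : C * (l.map fun p => k (p.2 - p.1)).sum + (l.map fun p => C * k (p.2 - p.1) -
      (f p.2 - f p.1)).sum = (l.map fun p => 2 * C * k (p.2 - p.1) - (f p.2 - f p.1)).sum := by
    rw [← List.sum_map_mul_left, ← List.sum_map_add]
    congr 2; funext p; ring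
  have hB : 0 ≤ (l.map fun p => C * k (p.2 - p.1) - (f p.2 - f p.1)).sum := by
    refine List.sum_nonneg fun z hz => ?_
    obtain ⟨p, hp, rfl⟩ := List.mem_map.1 hz
    obtain ⟨_, h2, _, h4⟩ := hl p hp
    linarith [hfk p.1 p.2 h2 h4]
  have hD : k 1 * (l.map fun p => p.2 - p.1).sum ≤ (l.map fun p => k (p.2 - p.1)).sum := by
    rw [← List.sum_map_mul_left]
    refine List.sum_le_sum fun p hp => ?_
    obtain ⟨_, h2, _, h4⟩ := hl p hp
    rw [mul_comm]
    exact hlin _ ⟨by linarith, by linarith⟩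
  have hE : ∀ (l : List (ℝ × ℝ)) (x y : ℝ), x ≤ y → (∀ p ∈ l, x ≤ p.1 ∧ p.1 ≤ p.2 ∧ p.2 ≤ y) →
      l.Pairwise (fun p q => q.2 ≤ p.1) → (l.map fun p => p.2 - p.1).sum ≤ y - x := by
    intro l
    induction l with
    | nil => intro x y hxy _ _; simpa using hxy
    | cons q l ih =>
      intro x y hxy h1 h2
      obtain ⟨h3, h4⟩ := List.pairwise_cons.1 h2
      have hq := h1 q (by simp)
      have := ih x q.1 hq.1 (fun p hp => ⟨(h1 p (by simp [hp])).1, (h1 p (by simp [hp])).2.1,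
        h3 p hp⟩) h4
      simp only [List.map_cons, List.sum_cons]
      linarith
  have hE' := hE l x y hxy (fun p hp => ⟨(hl p hp).1, (hl p hp).2.1, (hl p hp).2.2.1⟩) hlp
  set S := (l.map fun p => p.2 - p.1).sum
  set A := (l.map fun p => k (p.2 - p.1)).sum
  set B := (l.map fun p => C * k (p.2 - p.1) - (f p.2 - f p.1)).sum
  rw [← hA] at hls
  -- A chain of span `y - x` costs at least `C * k 1 * (y - x)` minus the oscillation `C * k 1` of
  -- `f`, so a negative cost forces a span below one period.
  have hyx1 : y ≤ x + 1 := by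
    by_contra hcon
    push Not at hcon
    have h1 : C * k 1 * (y - x - S) ≤ K * k 1 * (y - x - S) := by
      gcongr
    have h2 := mul_le_mul_of_nonneg_left hD hC.le
    have h3 := hosc y x
    have h4 : 0 < C * k 1 * (y - x - 1) := by
      have := mul_pos hC hk1
      apply mul_pos this; linarith
    nlinarith
  have hfR : f y - f x = -(f (x + 1) - f y) := by rw [hf x]; ring
  have hR := hfk y (x + 1) hyx1 (by linarith)
  have hR1 : k (x + 1 - y) ≤ k 1 := hkm (by linarith)
  have hrem : 0 ≤ K * k 1 * (y - x - S) :=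
    mul_nonneg (mul_nonneg (hC.le.trans hK) hk1.le) (by linarith)
  -- the sorted list
  let R : ℝ × ℝ → ℝ × ℝ → Prop := fun p q => q.2 - q.1 ≤ p.2 - p.1
  -- The added interval closes the period; by periodicity its increment of `f` is `f x - f y`.
  let l' := (y, x + 1) :: l
  have hl' : ∀ p ∈ l', x ≤ p.1 ∧ p.1 ≤ p.2 ∧ p.2 ≤ x + 1 := by
    intro p hp
    rcases List.mem_cons.1 hp with rfl | hp
    · exact ⟨hxy, hyx1, le_rfl⟩
    · obtain ⟨h1, h2, h3, _⟩ := hl p hp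
      exact ⟨h1, h2, h3.trans hyx1⟩
  have hl'p : l'.Pairwise (fun p q => q.2 ≤ p.1 ∨ p.2 ≤ q.1) :=
    List.pairwise_cons.2 ⟨fun q hq => Or.inl (hl q hq).2.2.1, hlp.imp Or.inl⟩
  have : Std.Total R := ⟨fun p q => le_total _ _⟩
  have : IsTrans (ℝ × ℝ) R := ⟨fun p q r h1 h2 => le_trans h2 h1⟩
  have : DecidableRel R := Classical.decRel _
  let m := l'.insertionSort R
  have hperm : m.Perm l' := List.perm_insertionSort R l'
  have hsort : m.Pairwise R := List.pairwise_insertionSort R l'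
  have hm : ∀ p ∈ m, x ≤ p.1 ∧ p.1 ≤ p.2 ∧ p.2 ≤ x + 1 := fun p hp => hl' p (hperm.mem_iff.1 hp)
  have hmp : m.Pairwise (fun p q => q.2 ≤ p.1 ∨ p.2 ≤ q.1) :=
    (hperm.pairwise_iff (fun h => h.symm)).2 hl'p
  -- Past the end of the list the default is a degenerate interval, which contributes nothing.
  let p : ℕ → ℝ × ℝ := fun n => m.getD n (x, x)
  have hp_lt : ∀ n (hn : n < m.length), p n = m[n] := fun n hn => by simp [p, hn]
  have hp_ge : ∀ n, m.length ≤ n → p n = (x, x) := fun n hn => by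
    simp [p, hn]
  have hp_mem : ∀ n, x ≤ (p n).1 ∧ (p n).1 ≤ (p n).2 ∧ (p n).2 ≤ x + 1 := by
    intro n
    rcases lt_or_ge n m.length with hn | hn
    · rw [hp_lt n hn]; exact hm _ (List.getElem_mem hn)
    · rw [hp_ge n hn]; simp
  have hsum : ∀ φ : ℝ × ℝ → ℝ, ∑ n ∈ Finset.range m.length, φ (p n) =
      φ (y, x + 1) + (l.map φ).sum := by
    intro φ
    have h1 : (m.map φ).sum = φ (y, x + 1) + (l.map φ).sum := by
      rw [(hperm.map φ).sum_eq]; simp [l']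
    rw [← h1, Finset.sum_range, ← Fin.sum_univ_getElem, ]
    simp only [List.getElem_map]
    refine Fintype.sum_equiv (finCongr (by simp)) _ _ ?_
    intro i
    simp [hp_lt i i.2]
  have hanti : ∀ i j, i ≤ j → (p j).2 - (p j).1 ≤ (p i).2 - (p i).1 := by
    intro i j hij
    rcases lt_or_ge j m.length with hj | hj
    · rcases hij.eq_or_lt with rfl | hij
      · exact le_rfl
      · rw [hp_lt j hj, hp_lt i (hij.trans hj)]
        exact List.pairwise_iff_getElem.1 hsort i j _ _ hij
    · rw [hp_ge j hj]; simpa using (hp_mem i).2.1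
  refine ⟨p, m.length, hp_mem, ?_, hanti, ?_, ?_, ?_, ?_⟩
  · have key : ∀ i j, i < j → (p j).2 ≤ (p i).1 ∨ (p i).2 ≤ (p j).1 := by
      intro i j hij
      rcases lt_or_ge j m.length with hj | hj
      · rw [hp_lt j hj, hp_lt i (hij.trans hj)]
        exact List.pairwise_iff_getElem.1 hmp i j _ _ hij
      · rw [hp_ge j hj]; exact Or.inl (hp_mem i).1
    intro i j hij
    rcases lt_or_gt_of_ne hij with hij | hij
    · exact (key i j hij).symm
    · exact key j i hij
  · intro n hn; rw [hp_ge n hn]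
  · rw [hsum fun q => k (q.2 - q.1)]
    change k (x + 1 - y) + A ≤ _
    have : C * A ≤ C * k 1 := by nlinarith
    linarith [le_of_mul_le_mul_left this hC]
  · rw [hsum fun q => q.2 - q.1]
    change K * (1 - (x + 1 - y + S)) ≤ C
    have hA0 : 0 ≤ C * A := mul_nonneg hC.le (List.sum_nonneg fun z hz => by
      obtain ⟨q, hq, rfl⟩ := List.mem_map.1 hz
      exact hknn _ (by linarith [(hl q hq).2.1]))
    have : K * (1 - (x + 1 - y + S)) * k 1 ≤ C * k 1 := by nlinarith
    exact le_of_mul_le_mul_right this hk1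
  · rw [hsum fun q => C * k (q.2 - q.1) - (f q.2 - f q.1)]
    change C * k (x + 1 - y) - (f (x + 1) - f y) + B ≤ _
    have hA0 : 0 ≤ C * A := mul_nonneg hC.le (List.sum_nonneg fun z hz => by
      obtain ⟨q, hq, rfl⟩ := List.mem_map.1 hz
      exact hknn _ (by linarith [(hl q hq).2.1]))
    -- The chain does not pay for the closing interval; its term `C * k` is charged to the longest
    -- interval `p 0`.
    obtain ⟨i, hi, hip⟩ := List.mem_iff_getElem.1 (hperm.mem_iff.2 (List.mem_cons_self (a := (y, x + 1)) (l := l)))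
    have h0 := hanti 0 i (Nat.zero_le _)
    rw [hp_lt i hi, hip] at h0
    have h1 := mul_le_mul_of_nonneg_left (hkm h0) hC.le
    simp only at h1
    linarith

theorem sub_le_stepCost {k f : ℝ → ℝ} {C K : ℝ} (hkm : Monotone k) (hk0 : k 0 = 0)
    (hC : 0 < C) (hK : C ≤ K)
    (hfk : ∀ s t, s ≤ t → t ≤ s + 1 → f t - f s ≤ C * k (t - s)) (u v : ℝ) (huv : u ≤ v)
    (hvu : v ≤ u + 1) : f v - f u ≤ stepCost k f (2 * C) K u v := by
  have h0 : 0 ≤ k (v - u) := hk0 ▸ hkm (by linarith)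
  have h1 := hfk u v huv hvu
  exact le_min (by nlinarith) (by nlinarith)

theorem stepCost_truncate {k f : ℝ → ℝ} {C K : ℝ} (hkm : Monotone k) (hk0 : k 0 = 0)
    (hC : 0 < C) (hK : C ≤ K)
    (hfk : ∀ s t, s ≤ t → t ≤ s + 1 → f t - f s ≤ C * k (t - s)) (u z v : ℝ) (huz : u ≤ z)
    (hzv : z ≤ v) (hvu : v ≤ u + 1) :
    stepCost k f (2 * C) K u z ≤ stepCost k f (2 * C) K u v + (f z - f v) + C * k (v - z) := by
  have h0 : 0 ≤ k (v - z) := hk0 ▸ hkm (by linarith)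
  have h1 := hfk z v hzv (by linarith)
  have h2 : k (z - u) ≤ k (v - u) := hkm (by linarith)
  rcases min_choice (2 * C * k (v - u)) (f v - f u + K * k (v - u)) with hm | hm
  · have h3 : stepCost k f (2 * C) K u z ≤ 2 * C * k (z - u) := min_le_left _ _
    have h4 : stepCost k f (2 * C) K u v = 2 * C * k (v - u) := hm
    nlinarith
  · have h3 : stepCost k f (2 * C) K u z ≤ f z - f u + K * k (z - u) := min_le_right _ _
    have h4 : stepCost k f (2 * C) K u v = f v - f u + K * k (v - u) := hm
    nlinarith

/-! ### The extremal splitting of the distribution function -/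

/-- If no chain is cheaper than `-ε`, the infimum of the costs of the chains ending at a point
splits off the required small part of `f`. -/
theorem exists_decomposition_of_chain_cost {k f : ℝ → ℝ} {C K ε : ℝ}
    (hkc : Continuous k) (hkm : Monotone k) (hk0 : k 0 = 0)
    (hf : Function.Periodic f 1) (hC : 0 < C)
    (hfk : ∀ s t, s ≤ t → t ≤ s + 1 → f t - f s ≤ C * k (t - s)) (hK : C ≤ K)
    (hchain : ∀ x y s, ForwardChain (stepCost k f (2 * C) K) x y s → -ε ≤ s) :
    ∃ G : ℝ → ℝ, Function.Periodic G 1 ∧ Continuous G ∧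
      (∀ s t, s ≤ t → t ≤ s + 1 → (f t - G t) - (f s - G s) ≤ 2 * C * k (t - s)) ∧
      (∀ s t, s ≤ t → t ≤ s + 1 → G s - G t ≤ K * k (t - s)) ∧
      (∀ s t, |(f t - G t) - (f s - G s)| ≤ ε) := by
  have hsub := sub_le_stepCost hkm hk0 hC hK hfk
  set c := stepCost k f (2 * C) K with hc
  let T : ℝ → Set ℝ := fun y => {s | ∃ x, ForwardChain c x y s}
  let h : ℝ → ℝ := fun y => sInf (T y)
  have hT0 : ∀ y, (0 : ℝ) ∈ T y := fun y => ⟨y, .nil⟩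
  have hTb : ∀ y, BddBelow (T y) := fun y => ⟨-ε, fun s ⟨x, hx⟩ => hchain x y s hx⟩
  have hle : ∀ x y s, ForwardChain c x y s → h y ≤ s := fun x y s hs => csInf_le (hTb y) ⟨x, hs⟩
  have hge : ∀ y z, (∀ x s, ForwardChain c x y s → z ≤ s) → z ≤ h y := fun y z hz =>
    le_csInf ⟨0, hT0 y⟩ fun s ⟨x, hx⟩ => hz x s hx
  have hnonpos : ∀ y, h y ≤ 0 := fun y => hle _ _ _ .nil
  have hlow : ∀ y, -ε ≤ h y := fun y => hge _ _ fun x s hs => hchain x y s hs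
  have hstep : ∀ u v, u ≤ v → v ≤ u + 1 → h v ≤ h u + c u v := by
    intro u v huv hvu
    rw [← sub_le_iff_le_add]
    refine hge _ _ fun x s hs => ?_
    linarith [hle _ _ _ (hs.snoc huv hvu)]
  -- Cutting chains at `z` bounds the increments of `f - h` from above; with the lower bound from
  -- `hstep` this gives continuity.
  have hback : ∀ z y, z ≤ y → y ≤ z + 1 → h z ≤ h y + (f z - f y) + C * k (y - z) := by
    intro z y hzy hyz
    have : h z - (f z - f y) - C * k (y - z) ≤ h y := by
      refine hge _ _ fun x s hs => ?_
      obtain ⟨x', s', h1, h2⟩ := hs.truncate (w := fun t => C * k t) hsub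
        (fun a b hab => mul_le_mul_of_nonneg_left (hkm hab) hC.le) hfk
        (stepCost_truncate hkm hk0 hC hK hfk) hzy hyz
      linarith [hle _ _ _ h1]
    linarith
  have hper : Function.Periodic h 1 := by
    intro y
    have h1 : ∀ u v, c (u + 1) (v + 1) = c u v := by
      intro u v; simp [hc, stepCost, hf u, hf v]
    have h2 : ∀ u v, c (u + -1) (v + -1) = c u v := by
      intro u v; rw [← h1 (u + -1)]; simp
    refine le_antisymm (hge _ _ fun x s hs => hle _ _ _ (hs.translate h1)) ?_
    refine hge _ _ fun x s hs => hle (x + -1) _ _ ?_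
    simpa using hs.translate h2
  have hGlow : ∀ s t, s ≤ t → t ≤ s + 1 → (f s - h s) - (f t - h t) ≤ K * k (t - s) := by
    intro s t hst hts
    have h1 := hstep s t hst hts
    have h2 : c s t ≤ _ := min_le_right _ _
    linarith
  have hGup : ∀ s t, s ≤ t → t ≤ s + 1 → (f t - h t) - (f s - h s) ≤ K * k (t - s) := by
    intro s t hst hts
    have h1 := hback s t hst hts
    have h0 : 0 ≤ k (t - s) := hk0 ▸ hkm (by linarith)
    nlinarith
  have hGabs : ∀ s t, |t - s| ≤ 1 → |(f t - h t) - (f s - h s)| ≤ K * k |t - s| := by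
    intro s t hst
    rcases le_total s t with hle | hle
    · rw [abs_of_nonneg (sub_nonneg.2 hle)] at hst ⊢
      rw [abs_le]
      have := hGlow s t hle (by linarith)
      have := hGup s t hle (by linarith)
      constructor <;> linarith
    · rw [abs_of_nonpos (sub_nonpos.2 hle), neg_sub] at hst ⊢
      rw [abs_le]
      have := hGlow t s hle (by linarith)
      have := hGup t s hle (by linarith)
      constructor <;> linarith
  refine ⟨fun t => f t - h t, fun t => by simp [hf t, hper t], ?_, ?_, hGlow, ?_⟩
  · rw [continuous_iff_continuousAt]
    intro s
    rw [ContinuousAt, tendsto_iff_dist_tendsto_zero]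
    have hlim : Tendsto (fun t => K * k |t - s|) (𝓝 s) (𝓝 0) := by
      have : Continuous fun t => K * k |t - s| := by fun_prop
      simpa [hk0] using this.tendsto s
    refine squeeze_zero' (Eventually.of_forall fun t => dist_nonneg) ?_ hlim
    filter_upwards [Metric.ball_mem_nhds s one_pos] with t ht
    rw [Metric.mem_ball, Real.dist_eq] at ht
    rw [Real.dist_eq]
    exact hGabs s t ht.le
  · intro s t hst hts
    have h1 := hstep s t hst hts
    have h2 : c s t ≤ _ := min_le_left _ _
    linarith
  · intro s t
    have := hnonpos s; have := hnonpos t; have := hlow s; have := hlow t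
    rw [abs_le]; constructor <;> linarith

/-! ### Compactness: cheap chains produce a charged Carleson set -/

/-- For large `K` no chain is cheaper than `-ε`, provided `f` has no mass on the sets of finite
entropy. -/
theorem exists_chain_cost_ge {k f : ℝ → ℝ} {C ε : ℝ}
    (hkc : Continuous k) (hkm : Monotone k) (hk0 : k 0 = 0)
    (hlin : ∀ t ∈ Icc (0 : ℝ) 1, t * k 1 ≤ k t) (hk1 : 0 < k 1)
    (hsup : ∀ T : ℝ, ∃ δ > 0, ∀ t ∈ Icc (0 : ℝ) δ, T * t ≤ k t)
    (hfc : Continuous f) (hf : Function.Periodic f 1) (hC : 0 < C)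
    (hfk : ∀ s t, s ≤ t → t ≤ s + 1 → f t - f s ≤ C * k (t - s))
    (hnull : ∀ (x : ℝ) (p : ℕ → ℝ × ℝ),
      (∀ n, x ≤ (p n).1 ∧ (p n).1 ≤ (p n).2 ∧ (p n).2 ≤ x + 1) →
      (∀ m n, m ≠ n → (p m).2 ≤ (p n).1 ∨ (p n).2 ≤ (p m).1) →
      HasSum (fun n => (p n).2 - (p n).1) 1 → Summable (fun n => k ((p n).2 - (p n).1)) →
      HasSum (fun n => f (p n).2 - f (p n).1) 0) (hε : 0 < ε) :
    ∃ K, C ≤ K ∧ ∀ x y s, ForwardChain (stepCost k f (2 * C) K) x y s → -ε ≤ s := by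
  by_contra! hcon
  have hknn : ∀ t, 0 ≤ t → 0 ≤ k t := fun t ht => hk0 ▸ hkm ht
  have hex : ∀ j : ℕ, ∃ (x : ℝ) (p : ℕ → ℝ × ℝ) (L : ℕ), x ∈ Icc (0 : ℝ) 1 ∧
      (∀ n, x ≤ (p n).1 ∧ (p n).1 ≤ (p n).2 ∧ (p n).2 ≤ x + 1) ∧
      (∀ m n, m ≠ n → (p m).2 ≤ (p n).1 ∨ (p n).2 ≤ (p m).1) ∧
      (∀ m n, m ≤ n → (p n).2 - (p n).1 ≤ (p m).2 - (p m).1) ∧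
      (∀ n, L ≤ n → (p n).2 = (p n).1) ∧
      (∑ n ∈ Finset.range L, k ((p n).2 - (p n).1) ≤ 2 * k 1) ∧
      ((C + j) * (1 - ∑ n ∈ Finset.range L, ((p n).2 - (p n).1)) ≤ C) ∧
      (∑ n ∈ Finset.range L, (C * k ((p n).2 - (p n).1) - (f (p n).2 - f (p n).1)) ≤
        -ε + C * k ((p 0).2 - (p 0).1)) := by
    intro j
    -- The constants `K = C + j` tend to infinity, so the missing length, at most `C / (C + j)`,
    -- tends to zero.
    have hCj : C ≤ C + j := by simp
    obtain ⟨x, y, s, hch, hs⟩ := hcon (C + j) hCj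
    have htr : ∀ u v, stepCost k f (2 * C) (C + j) (u + (-⌊x⌋ : ℝ)) (v + (-⌊x⌋ : ℝ)) =
        stepCost k f (2 * C) (C + j) u v := by
      intro u v
      have : ∀ u, f (u + (-⌊x⌋ : ℝ)) = f u := fun u => by
        simpa [sub_eq_add_neg] using hf.sub_int_mul_eq ⌊x⌋ (x := u)
      simp [stepCost, this]
    obtain ⟨p, L, h⟩ := (hch.translate htr).exists_seq hkm hk0 hlin hk1 hf hC hfk hCj hε hs
    exact ⟨x + (-⌊x⌋ : ℝ), p, L, ⟨by linarith [Int.floor_le x],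
      by linarith [Int.lt_floor_add_one x]⟩, h⟩
  choose X P L hX hP hdisj hanti hL hent hlen hmass using hex
  -- all the partial sums are controlled by the full ones
  have hpart : ∀ (φ : ℝ × ℝ → ℝ) (j N : ℕ), (∀ n, 0 ≤ φ (P j n)) →
      (∀ q : ℝ × ℝ, q.2 = q.1 → φ q = 0) →
      ∑ n ∈ Finset.range N, φ (P j n) ≤ ∑ n ∈ Finset.range (L j), φ (P j n) := by
    intro φ j N h0 hz
    have h1 : ∑ n ∈ Finset.range N, φ (P j n) ≤ ∑ n ∈ Finset.range (max N (L j)), φ (P j n) :=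
      Finset.sum_le_sum_of_subset_of_nonneg (by simp) fun n _ _ => h0 n
    refine h1.trans_eq (Finset.sum_subset (by simp) fun n _ hn => ?_).symm
    exact hz _ (hL j n (by simpa using hn))
  have hent' : ∀ j N, ∑ n ∈ Finset.range N, k ((P j n).2 - (P j n).1) ≤ 2 * k 1 := fun j N =>
    (hpart (fun q => k (q.2 - q.1)) j N (fun n => hknn _ (by linarith [(hP j n).2.1]))
      (fun q hq => by simp [hq, hk0])).trans (hent j)
  -- The terms are nonnegative, so the bound passes to partial sums of fixed length `N`. This allows
  -- a Fatou argument in the limit.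
  have hmass' : ∀ j N, ∑ n ∈ Finset.range N, (C * k ((P j n).2 - (P j n).1) -
      (f (P j n).2 - f (P j n).1)) ≤ -ε + C * k ((P j 0).2 - (P j 0).1) := fun j N =>
    (hpart (fun q => C * k (q.2 - q.1) - (f q.2 - f q.1)) j N
      (fun n => by
        obtain ⟨h1, h2, h3⟩ := hP j n
        linarith [hfk _ _ h2 (by linarith)])
      (fun q hq => by simp [hq, hk0])).trans (hmass j)
  -- the tails of the lengths are uniformly small
  have htail : ∀ T : ℝ, 0 < T → ∃ N, ∀ j,
      1 - C / (C + j) - 2 * k 1 / T ≤ ∑ n ∈ Finset.range N, ((P j n).2 - (P j n).1) := by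
    intro T hT
    obtain ⟨δ, hδ, hδT⟩ := hsup T
    have hkδ : 0 < k δ := (mul_pos hT hδ).trans_le (hδT δ ⟨hδ.le, le_rfl⟩)
    -- If the interval of some index `n ≥ N` were longer than `δ`, so would be the first `N`, and
    -- their entropy would exceed `2 * k 1`.
    obtain ⟨N, hN⟩ := exists_nat_gt (2 * k 1 / k δ)
    refine ⟨N, fun j => ?_⟩
    have hsmall : ∀ n, N ≤ n → (P j n).2 - (P j n).1 ≤ δ := by
      intro n hn
      by_contra! hlt
      have h1 : (N : ℝ) * k δ ≤ ∑ i ∈ Finset.range N, k ((P j i).2 - (P j i).1) := by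
        rw [← nsmul_eq_mul, ← Finset.card_range N]
        simp only [Finset.card_range]
        refine (Finset.card_nsmul_le_sum (Finset.range N) _ (k δ) fun i hi => ?_).trans' (by simp)
        exact hkm (hlt.le.trans (hanti j i n ((Finset.mem_range.1 hi).le.trans hn)))
      rw [div_lt_iff₀ hkδ] at hN
      linarith [hent' j N]
    have hCj : 0 < C + (j : ℝ) := by positivity
    have h1 : 1 - C / (C + j) ≤ ∑ n ∈ Finset.range (L j), ((P j n).2 - (P j n).1) := by
      have : 1 - ∑ n ∈ Finset.range (L j), ((P j n).2 - (P j n).1) ≤ C / (C + j) := by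
        rw [le_div_iff₀ hCj, mul_comm]; exact hlen j
      linarith
    have h2 : ∑ n ∈ Finset.range (L j), ((P j n).2 - (P j n).1) ≤
        ∑ n ∈ Finset.range (N + L j), ((P j n).2 - (P j n).1) :=
      Finset.sum_le_sum_of_subset_of_nonneg (by simp) fun n _ _ => by linarith [(hP j n).2.1]
    have h3 : ∑ n ∈ Finset.range (L j), ((P j (N + n)).2 - (P j (N + n)).1) ≤ 2 * k 1 / T := by
      rw [le_div_iff₀ hT, Finset.sum_mul]
      calc ∑ n ∈ Finset.range (L j), ((P j (N + n)).2 - (P j (N + n)).1) * T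
          ≤ ∑ n ∈ Finset.range (L j), k ((P j (N + n)).2 - (P j (N + n)).1) := by
            refine Finset.sum_le_sum fun n _ => ?_
            rw [mul_comm]
            exact hδT _ ⟨by linarith [(hP j (N + n)).2.1], hsmall _ (by simp)⟩
        _ ≤ ∑ n ∈ Finset.range (N + L j), k ((P j n).2 - (P j n).1) := by
            rw [Finset.sum_range_add]
            have : 0 ≤ ∑ n ∈ Finset.range N, k ((P j n).2 - (P j n).1) :=
              Finset.sum_nonneg fun n _ => hknn _ (by linarith [(hP j n).2.1])
            linarith
        _ ≤ _ := hent' j _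
    rw [Finset.sum_range_add] at h2
    linarith
  -- pass to the limit along a subsequence
  have hcomp : IsCompact ((Set.univ.pi fun _ : ℕ => Icc ((0 : ℝ), (0 : ℝ)) (2, 2)) ×ˢ
      Icc (0 : ℝ) 1) := (isCompact_univ_pi fun _ => isCompact_Icc).prod isCompact_Icc
  obtain ⟨⟨p, x⟩, -, φ, hφ, hlim⟩ := hcomp.tendsto_subseq (x := fun j => (P j, X j)) fun j => by
    refine ⟨fun n _ => ?_, hX j⟩
    obtain ⟨h1, h2, h3⟩ := hP j n
    obtain ⟨h4, h5⟩ := hX j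
    exact ⟨⟨by simp; linarith, by simp; linarith⟩, ⟨by simp; linarith, by simp; linarith⟩⟩
  have hx : Tendsto (fun j => X (φ j)) atTop (𝓝 x) := (continuous_snd.tendsto _).comp hlim
  have hp : ∀ n, Tendsto (fun j => P (φ j) n) atTop (𝓝 (p n)) := fun n =>
    (((continuous_apply n).comp continuous_fst).tendsto _).comp hlim
  have hp1 : ∀ n, Tendsto (fun j => (P (φ j) n).1) atTop (𝓝 (p n).1) := fun n =>
    (continuous_fst.tendsto _).comp (hp n)
  have hp2 : ∀ n, Tendsto (fun j => (P (φ j) n).2) atTop (𝓝 (p n).2) := fun n =>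
    (continuous_snd.tendsto _).comp (hp n)
  have hkp : ∀ n, Tendsto (fun j => k ((P (φ j) n).2 - (P (φ j) n).1)) atTop
      (𝓝 (k ((p n).2 - (p n).1))) := fun n => (hkc.tendsto _).comp ((hp2 n).sub (hp1 n))
  have hpx : ∀ n, x ≤ (p n).1 ∧ (p n).1 ≤ (p n).2 ∧ (p n).2 ≤ x + 1 := fun n =>
    ⟨le_of_tendsto_of_tendsto' hx (hp1 n) fun j => (hP _ n).1,
      le_of_tendsto_of_tendsto' (hp1 n) (hp2 n) fun j => (hP _ n).2.1,
      le_of_tendsto_of_tendsto' (hp2 n) (hx.add_const 1) fun j => (hP _ n).2.2⟩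
  have hpd : ∀ m n, m ≠ n → (p m).2 ≤ (p n).1 ∨ (p n).2 ≤ (p m).1 := by
    intro m n hmn
    by_contra! hlt
    have h1 := (hp1 n).eventually_lt (hp2 m) hlt.1
    have h2 := (hp1 m).eventually_lt (hp2 n) hlt.2
    obtain ⟨j, h1, h2⟩ := (h1.and h2).exists
    rcases hdisj (φ j) m n hmn with h | h <;> linarith
  have hpent : ∀ N, ∑ n ∈ Finset.range N, k ((p n).2 - (p n).1) ≤ 2 * k 1 := fun N =>
    le_of_tendsto' (tendsto_finsetSum _ fun n _ => hkp n) fun j => hent' _ N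
  have hpmass : ∀ N, ∑ n ∈ Finset.range N, (C * k ((p n).2 - (p n).1) -
      (f (p n).2 - f (p n).1)) ≤ -ε + C * k ((p 0).2 - (p 0).1) := fun N =>
    le_of_tendsto_of_tendsto' (tendsto_finsetSum _ fun n _ => ((hkp n).const_mul C).sub
      (((hfc.tendsto _).comp (hp2 n)).sub ((hfc.tendsto _).comp (hp1 n))))
      (((hkp 0).const_mul C).const_add (-ε)) fun j => hmass' _ N
  have hps : Summable fun n => k ((p n).2 - (p n).1) :=
    summable_of_sum_range_le (fun n => hknn _ (by linarith [(hpx n).2.1])) hpent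
  have hplen_le : ∀ N, ∑ n ∈ Finset.range N, ((p n).2 - (p n).1) ≤ 1 := by
    intro N
    refine le_of_tendsto' (tendsto_finsetSum _ fun n _ => (hp2 n).sub (hp1 n)) fun j => ?_
    have key : ∀ N, (∑ n ∈ Finset.range N, ((P (φ j) n).2 - (P (φ j) n).1)) =
        (volume (⋃ n ∈ Finset.range N, Ioo (P (φ j) n).1 (P (φ j) n).2)).toReal := by
      intro N
      rw [measure_biUnion_finset]
      · rw [ENNReal.toReal_sum (by simp)]
        refine Finset.sum_congr rfl fun n _ => ?_
        rw [Real.volume_Ioo, ENNReal.toReal_ofReal (by linarith [(hP (φ j) n).2.1])]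
      · intro m _ n _ hmn
        rw [Function.onFun, Set.disjoint_left]
        rintro t ⟨h1, h2⟩ ⟨h3, h4⟩
        rcases hdisj (φ j) m n hmn with h | h <;> linarith
      · intro n _; exact measurableSet_Ioo
    rw [key]
    have hsub : (⋃ n ∈ Finset.range N, Ioo (P (φ j) n).1 (P (φ j) n).2) ⊆
        Icc (X (φ j)) (X (φ j) + 1) := by
      refine iUnion₂_subset fun n _ t ht => ?_
      obtain ⟨h1, h2, h3⟩ := hP (φ j) n
      exact ⟨h1.trans ht.1.le, ht.2.le.trans h3⟩
    have h1 := measure_mono (μ := volume) hsub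
    rw [Real.volume_Icc] at h1
    simp only [add_sub_cancel_left] at h1
    simpa using ENNReal.toReal_mono (by simp) h1
  have hplen : HasSum (fun n => (p n).2 - (p n).1) 1 := by
    refine hasSum_of_isLUB_of_nonneg _ (fun n => by linarith [(hpx n).2.1]) ⟨?_, ?_⟩
    · rintro _ ⟨S, rfl⟩
      obtain ⟨N, hN⟩ := S.exists_nat_subset_range
      exact (Finset.sum_le_sum_of_subset_of_nonneg hN fun n _ _ => by
        linarith [(hpx n).2.1]).trans (hplen_le N)
    · intro B hB
      have h1 : ∀ T : ℝ, 0 < T → 1 - 0 - 2 * k 1 / T ≤ B := by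
        intro T hT
        obtain ⟨N, hN⟩ := htail T hT
        refine le_trans ?_ (hB ⟨Finset.range N, rfl⟩)
        have hz : Tendsto (fun j : ℕ => C / (C + (φ j : ℝ))) atTop (𝓝 0) :=
          tendsto_const_nhds.div_atTop (tendsto_atTop_add_const_left _ _
            (tendsto_natCast_atTop_atTop.comp hφ.tendsto_atTop))
        exact le_of_tendsto_of_tendsto' ((hz.const_sub 1).sub_const _)
          (tendsto_finsetSum _ fun n _ => (hp2 n).sub (hp1 n)) fun j => hN (φ j)
      have hz : Tendsto (fun T : ℝ => 1 - 0 - 2 * k 1 / T) atTop (𝓝 (1 - 0 - 0)) :=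
        (tendsto_const_nhds.div_atTop tendsto_id).const_sub _
      have := le_of_tendsto hz (eventually_gt_atTop 0 |>.mono fun T hT => h1 T hT)
      linarith
  have hzero := hnull x p hpx hpd hplen hps
  -- With `N + 1` terms the index `0` is included, so the entropy sum absorbs the term `C * k` of
  -- the longest interval.
  have hfin : ∀ N : ℕ, ε ≤ ∑ n ∈ Finset.range (N + 1), (f (p n).2 - f (p n).1) := by
    intro N
    have h1 := hpmass (N + 1)
    rw [Finset.sum_sub_distrib, ← Finset.mul_sum] at h1
    have h2 : k ((p 0).2 - (p 0).1) ≤ ∑ n ∈ Finset.range (N + 1), k ((p n).2 - (p n).1) :=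
      Finset.single_le_sum (f := fun n => k ((p n).2 - (p n).1))
        (fun n _ => hknn _ (by linarith [(hpx n).2.1])) (by simp)
    nlinarith
  have := ge_of_tendsto' ((tendsto_add_atTop_iff_nat 1).2 hzero.tendsto_sum_nat) hfin
  linarith

/-! ### Arcs of the circle as projected intervals -/

/-- The image on the circle of a set of reals. -/
abbrev proj (J : Set ℝ) : Set Torus := (fun t : ℝ => (t : Torus)) '' J

theorem continuous_coe : Continuous fun t : ℝ => (t : Torus) := AddCircle.continuous_mk' 1

theorem isOpen_proj {J : Set ℝ} (hJ : IsOpen J) : IsOpen (proj J) :=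
  QuotientAddGroup.isOpenMap_coe J hJ

theorem injOn_coe_Ico (x : ℝ) : InjOn (fun t : ℝ => (t : Torus)) (Ico x (x + 1)) :=
  fun _ hs _ ht h => (AddCircle.coe_eq_coe_iff_of_mem_Ico hs ht).1 h

theorem injOn_coe_Ioc (x : ℝ) : InjOn (fun t : ℝ => (t : Torus)) (Ioc x (x + 1)) :=
  fun _ hs _ ht h => (AddCircle.coe_eq_coe_iff_of_mem_Ioc hs ht).1 h

theorem coe_add_int (t : ℝ) (n : ℤ) : ((t + n : ℝ) : Torus) = (t : Torus) := by
  rw [AddCircle.coe_add]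
  have : ((n : ℝ) : Torus) = 0 := (AddCircle.coe_eq_zero_iff 1).2 ⟨n, by simp⟩
  rw [this, add_zero]

theorem proj_Ico_add_int (a b : ℝ) (n : ℤ) : proj (Ico (a + n) (b + n)) = proj (Ico a b) := by
  rw [proj, ← Set.image_add_const_Ico, Set.image_image]
  simp only [coe_add_int]

theorem proj_Ico_univ (a : ℝ) : proj (Ico a (a + 1)) = univ := AddCircle.coe_image_Ico_eq 1 a

theorem proj_inter_eq_empty {x : ℝ} {J₁ J₂ : Set ℝ} (h₁ : J₁ ⊆ Ico x (x + 1))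
    (h₂ : J₂ ⊆ Ico x (x + 1)) (h : J₁ ∩ J₂ = ∅) : proj J₁ ∩ proj J₂ = ∅ := by
  rw [← (injOn_coe_Ico x).image_inter h₁ h₂, h, image_empty]

theorem proj_inter_eq_empty' {x : ℝ} {J₁ J₂ : Set ℝ} (h₁ : J₁ ⊆ Ioc x (x + 1))
    (h₂ : J₂ ⊆ Ioc x (x + 1)) (h : J₁ ∩ J₂ = ∅) : proj J₁ ∩ proj J₂ = ∅ := by
  rw [← (injOn_coe_Ioc x).image_inter h₁ h₂, h, image_empty]

theorem isArc_Icc {a b : ℝ} (hab : a ≤ b) (hba : b ≤ a + 1) : IsArc (proj (Icc a b)) :=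
  ⟨a, b, hab, hba, Or.inl rfl⟩

theorem isArc_Ico {a b : ℝ} (hab : a ≤ b) (hba : b ≤ a + 1) : IsArc (proj (Ico a b)) :=
  ⟨a, b, hab, hba, Or.inr (Or.inl rfl)⟩

theorem isArc_Ioc {a b : ℝ} (hab : a ≤ b) (hba : b ≤ a + 1) : IsArc (proj (Ioc a b)) :=
  ⟨a, b, hab, hba, Or.inr (Or.inr (Or.inl rfl))⟩

theorem isArc_Ioo {a b : ℝ} (hab : a ≤ b) (hba : b ≤ a + 1) : IsArc (proj (Ioo a b)) :=
  ⟨a, b, hab, hba, Or.inr (Or.inr (Or.inr rfl))⟩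

theorem isArc_singleton (a : ℝ) : IsArc (proj {a}) := by
  rw [← Icc_self]; exact isArc_Icc le_rfl (by linarith)

theorem isArc_empty : IsArc ∅ := by
  simpa using isArc_Ioo (le_refl (0 : ℝ)) (by norm_num)

theorem IsArc.exists_proj {I : Set Torus} (h : IsArc I) : ∃ (a b : ℝ) (J : Set ℝ), a ≤ b ∧
    b ≤ a + 1 ∧ Ioo a b ⊆ J ∧ J ⊆ Icc a b ∧ I = proj J := by
  obtain ⟨a, b, hab, hba, h⟩ := h
  refine ⟨a, b, ?_⟩
  rcases h with h | h | h | h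
  · exact ⟨_, hab, hba, Ioo_subset_Icc_self, le_rfl, h⟩
  · exact ⟨_, hab, hba, Ioo_subset_Ico_self, Ico_subset_Icc_self, h⟩
  · exact ⟨_, hab, hba, Ioo_subset_Ioc_self, Ioc_subset_Icc_self, h⟩
  · exact ⟨_, hab, hba, le_rfl, Ioo_subset_Icc_self, h⟩

theorem measurableSet_proj {a b : ℝ} {J : Set ℝ} (h₁ : Ioo a b ⊆ J) (h₂ : J ⊆ Icc a b) :
    MeasurableSet (proj J) := by
  have hfin : (J \ Ioo a b).Finite := by
    refine (Set.toFinite {a, b}).subset fun t ht => ?_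
    rcases (h₂ ht.1).1.eq_or_lt with h | h
    · exact Or.inl h.symm
    · rcases (h₂ ht.1).2.eq_or_lt with h' | h'
      · exact Or.inr h'
      · exact absurd ⟨h, h'⟩ ht.2
  have : proj J = proj (Ioo a b) ∪ proj (J \ Ioo a b) := by
    rw [proj, proj, proj, ← image_union, union_sdiff_cancel h₁]
  rw [this]
  exact (isOpen_proj isOpen_Ioo).measurableSet.union (hfin.image _).measurableSet

/-- Endpoints are null, so length and integral of an arc do not depend on which of them it contains.
-/
theorem proj_preimage_ae_eq {a b : ℝ} (hba : b ≤ a + 1) {J : Set ℝ}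
    (h₁ : Ioo a b ⊆ J) (h₂ : J ⊆ Icc a b) :
    (Ioc a (a + 1) ∩ (fun t : ℝ => (t : Torus)) ⁻¹' proj J : Set ℝ) =ᵐ[volume] Ioc a b := by
  have hne : ∀ c : ℝ, ∀ᵐ t : ℝ, t ≠ c := fun c => by
    simp [ae_iff]
  filter_upwards [hne a, hne b, hne (a + 1)] with t hta htb hta1
  refine propext ⟨fun ⟨ht, s, hs, hst⟩ => ?_, fun ht => ⟨⟨ht.1, ht.2.trans hba⟩, t,
    h₁ ⟨ht.1, lt_of_le_of_ne ht.2 htb⟩, rfl⟩⟩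
  have hs' := h₂ hs
  rcases (hs'.2.trans hba).eq_or_lt with h | h
  · have h1 : t ∈ Ioc a (a + 1) := ht
    have h2 : s ∈ Ioc a (a + 1) := ⟨by linarith, h.le⟩
    exact absurd ((injOn_coe_Ioc a h2 h1 hst).symm.trans h) hta1
  · have h1 : t ∈ Ico a (a + 1) := ⟨ht.1.le, lt_of_le_of_ne ht.2 hta1⟩
    have h2 : s ∈ Ico a (a + 1) := ⟨hs'.1, h⟩
    have h3 : s = t := injOn_coe_Ico a h2 h1 hst
    exact ⟨ht.1, h3 ▸ hs'.2⟩

theorem volume_proj {a b : ℝ} (hba : b ≤ a + 1) {J : Set ℝ} (h₁ : Ioo a b ⊆ J)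
    (h₂ : J ⊆ Icc a b) : volume (proj J) = ENNReal.ofReal (b - a) := by
  have hm := measurableSet_proj h₁ h₂
  rw [← (UnitAddCircle.measurePreserving_mk a).measure_preimage hm.nullMeasurableSet,
    Measure.restrict_apply (continuous_coe.measurable hm), inter_comm,
    measure_congr (proj_preimage_ae_eq hba h₁ h₂), Real.volume_Ioc]

theorem len_proj {a b : ℝ} (hab : a ≤ b) (hba : b ≤ a + 1) {J : Set ℝ} (h₁ : Ioo a b ⊆ J)
    (h₂ : J ⊆ Icc a b) : len (proj J) = b - a := by
  rw [len, measureReal_def, volume_proj hba h₁ h₂, ENNReal.toReal_ofReal (by linarith)]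

theorem len_Ico {a b : ℝ} (hab : a ≤ b) (hba : b ≤ a + 1) : len (proj (Ico a b)) = b - a :=
  len_proj hab hba Ioo_subset_Ico_self Ico_subset_Icc_self

theorem len_Ioo {a b : ℝ} (hab : a ≤ b) (hba : b ≤ a + 1) : len (proj (Ioo a b)) = b - a :=
  len_proj hab hba le_rfl Ioo_subset_Icc_self

theorem len_mem_Icc (I : Set Torus) : len I ∈ Icc (0 : ℝ) 1 := by
  refine ⟨measureReal_nonneg, ?_⟩
  have h := measureReal_mono (μ := (volume : Measure Torus)) (subset_univ I)
  rw [len]; exact h.trans_eq (by simp [measureReal_def])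

theorem setIntegral_proj {a b : ℝ} (hab : a ≤ b) (hba : b ≤ a + 1) {J : Set ℝ} (h₁ : Ioo a b ⊆ J)
    (h₂ : J ⊆ Icc a b) (g : Torus → ℝ) : ∫ x in proj J, g x = ∫ t in a..b, g t := by
  have hm := measurableSet_proj h₁ h₂
  rw [← integral_indicator hm, ← UnitAddCircle.integral_preimage a,
    intervalIntegral.integral_of_le hab]
  have : (fun t : ℝ => (proj J).indicator g (t : Torus)) =
      ((fun t : ℝ => (t : Torus)) ⁻¹' proj J).indicator fun t : ℝ => g t := rfl
  rw [this, setIntegral_indicator (continuous_coe.measurable hm)]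
  exact setIntegral_congr_set (proj_preimage_ae_eq hba h₁ h₂)

/-! ### Premeasures and distribution functions -/

namespace IsPremeasure

variable {μ : Set Torus → ℝ}

theorem empty (hμ : IsPremeasure μ) : μ ∅ = 0 := by
  have h := hμ.union ∅ ∅ isArc_empty isArc_empty (by simpa using isArc_empty) (by simp)
  simp only [union_self] at h
  linarith

theorem Ico_add_Ico (hμ : IsPremeasure μ) {a b c : ℝ} (hab : a ≤ b) (hbc : b ≤ c)
    (hca : c ≤ a + 1) : μ (proj (Ico a b)) + μ (proj (Ico b c)) = μ (proj (Ico a c)) := by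
  have hU : proj (Ico a b) ∪ proj (Ico b c) = proj (Ico a c) := by
    rw [proj, proj, ← image_union, Ico_union_Ico_eq_Ico hab hbc]
  rw [← hU]
  refine (hμ.union _ _ (isArc_Ico hab (by linarith)) (isArc_Ico hbc (by linarith)) ?_ ?_).symm
  · rw [hU]; exact isArc_Ico (hab.trans hbc) hca
  · refine proj_inter_eq_empty (x := a) (Ico_subset_Ico_right (by linarith))
      (Ico_subset_Ico hab hca) ?_
    ext t; simp; intro _ _ _; linarith

theorem singleton_add_Ioo (hμ : IsPremeasure μ) {a b : ℝ} (hab : a < b)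
    (hba : b ≤ a + 1) : μ (proj {a}) + μ (proj (Ioo a b)) = μ (proj (Ico a b)) := by
  have hU : proj {a} ∪ proj (Ioo a b) = proj (Ico a b) := by
    rw [proj, proj, ← image_union, union_comm, Ioo_union_left hab]
  rw [← hU]
  refine (hμ.union _ _ (isArc_singleton a) (isArc_Ioo hab.le hba) ?_ ?_).symm
  · rw [hU]; exact isArc_Ico hab.le hba
  · refine proj_inter_eq_empty (x := a) (singleton_subset_iff.2 ⟨le_rfl, by linarith⟩)
      (Ioo_subset_Ico_self.trans (Ico_subset_Ico_right hba)) ?_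
    ext t; simp

theorem Ioo_add_singleton (hμ : IsPremeasure μ) {a b : ℝ} (hab : a < b)
    (hba : b ≤ a + 1) : μ (proj (Ioo a b)) + μ (proj {b}) = μ (proj (Ioc a b)) := by
  have hU : proj (Ioo a b) ∪ proj {b} = proj (Ioc a b) := by
    rw [proj, proj, ← image_union, Ioo_union_right hab]
  rw [← hU]
  refine (hμ.union _ _ (isArc_Ioo hab.le hba) (isArc_singleton b) ?_ ?_).symm
  · rw [hU]; exact isArc_Ioc hab.le hba
  · refine proj_inter_eq_empty' (x := a) (Ioo_subset_Ioc_self.trans (Ioc_subset_Ioc_right hba))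
      (singleton_subset_iff.2 ⟨hab, hba⟩) ?_
    ext t; simp

theorem Ico_add_singleton (hμ : IsPremeasure μ) {a b : ℝ} (hab : a ≤ b)
    (hba : b < a + 1) : μ (proj (Ico a b)) + μ (proj {b}) = μ (proj (Icc a b)) := by
  have hU : proj (Ico a b) ∪ proj {b} = proj (Icc a b) := by
    rw [proj, proj, ← image_union, Ico_union_right hab]
  rw [← hU]
  refine (hμ.union _ _ (isArc_Ico hab hba.le) (isArc_singleton b) ?_ ?_).symm
  · rw [hU]; exact isArc_Icc hab hba.le
  · refine proj_inter_eq_empty (x := a) (Ico_subset_Ico_right hba.le)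
      (singleton_subset_iff.2 ⟨hab, hba⟩) ?_
    ext t; simp

/-- The distribution function of `μ`, extended periodically. -/
theorem exists_distribution (hμ : IsPremeasure μ) : ∃ f : ℝ → ℝ, Function.Periodic f 1 ∧
    ∀ s t, s ≤ t → t ≤ s + 1 → μ (proj (Ico s t)) = f t - f s := by
  let f : ℝ → ℝ := fun t => μ (proj (Ico 0 (Int.fract t)))
  have hf : Function.Periodic f 1 := fun t => by simp [f]
  have hfI : ∀ (t : ℝ) (n : ℤ), f (t + n) = f t := fun t n => by simp [f]
  have hf1 : ∀ t, 0 ≤ t → t < 1 → f t = μ (proj (Ico 0 t)) := fun t h0 h1 => by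
    simp only [f]; rw [Int.fract_eq_self.2 ⟨h0, h1⟩]
  refine ⟨f, hf, ?_⟩
  have key : ∀ s t, 0 ≤ s → s < 1 → s ≤ t → t ≤ s + 1 → μ (proj (Ico s t)) = f t - f s := by
    intro s t h0 h1 hst hts
    rw [hf1 s h0 h1]
    rcases lt_or_ge t 1 with ht | ht
    -- An interval inside `[0, 1)` is a difference of initial intervals. One reaching `1` is cut
    -- there, and `μ` of the whole circle being zero makes the periodic extension consistent.
    · rw [hf1 t (h0.trans hst) ht, ← hμ.Ico_add_Ico h0 hst (by linarith)]; ring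
    · have h2 : f t = μ (proj (Ico 0 (t - 1))) := by
        rw [← hf1 (t - 1) (by linarith) (by linarith)]; simpa using hf (t - 1)
      have h3 := proj_Ico_add_int 0 (t - 1) 1
      simp only [zero_add, Int.cast_one, sub_add_cancel] at h3
      have h4 := hμ.Ico_add_Ico h0 h1.le (by linarith)
      have h5 := proj_Ico_univ 0
      rw [zero_add] at h5
      rw [h5, hμ.univ] at h4
      rw [h2, ← h3, ← hμ.Ico_add_Ico h1.le ht hts]
      linarith
  intro s t hst hts
  have h := key (s + (-⌊s⌋ : ℤ)) (t + (-⌊s⌋ : ℤ)) (by push_cast; linarith [Int.floor_le s])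
    (by push_cast; linarith [Int.lt_floor_add_one s]) (by linarith) (by linarith)
  rwa [proj_Ico_add_int, hfI, hfI] at h

theorem arc_eq (hμ : IsPremeasure μ) {f : ℝ → ℝ} (hf : Function.Periodic f 1)
    (hμf : ∀ s t, s ≤ t → t ≤ s + 1 → μ (proj (Ico s t)) = f t - f s)
    (hatom : ∀ a, μ (proj {a}) = 0) {a b : ℝ} (hab : a ≤ b) (hba : b ≤ a + 1) :
    μ (proj (Icc a b)) = f b - f a ∧ μ (proj (Ico a b)) = f b - f a ∧
      μ (proj (Ioc a b)) = f b - f a ∧ μ (proj (Ioo a b)) = f b - f a := by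
  have h0 := hμf a b hab hba
  refine ⟨?_, h0, ?_⟩
  -- When `b = a + 1` the endpoints coincide on the circle and cannot be split off as a disjoint
  -- point; the total mass zero gives the value.
  · rcases hba.eq_or_lt with h | h
    · have : proj (Icc a b) = Set.univ := by rw [h]; exact AddCircle.coe_image_Icc_eq 1 a
      rw [this, hμ.univ, h, hf a, sub_self]
    · rw [← hμ.Ico_add_singleton hab h, hatom, h0, add_zero]
  · rcases hab.eq_or_lt with rfl | h
    · simp [hμ.empty]
    · have h1 := hμ.singleton_add_Ioo h hba
      rw [hatom, zero_add, h0] at h1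
      exact ⟨by rw [← hμ.Ioo_add_singleton h hba, hatom, h1, add_zero], h1⟩

end IsPremeasure

/-- Continuous periodic functions are distribution functions of premeasures. -/
theorem exists_premeasure {G : ℝ → ℝ} (hG : Function.Periodic G 1) (hGc : Continuous G) :
    ∃ ν : Set Torus → ℝ, IsPremeasure ν ∧ ∀ (a b : ℝ) (J : Set ℝ), a ≤ b → b ≤ a + 1 →
      Ioo a b ⊆ J → J ⊆ Icc a b → ν (proj J) = G b - G a := by
  let H : Torus → ℝ := hG.lift
  have hHc : Continuous H := continuous_coinduced_dom.2 hGc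
  have hH : ∀ t : ℝ, H (t : Torus) = G t := fun t => hG.lift_coe t
  let D : ℕ → Torus → ℝ := fun n x =>
    ((n : ℝ) + 1) * (H (x + ((1 / ((n : ℝ) + 1) : ℝ) : Torus)) - H x)
  have hDc : ∀ n, Continuous (D n) := fun n => by fun_prop
  have hDi : ∀ n I, IntegrableOn (D n) I := fun n I =>
    ((hDc n).continuousOn.integrableOn_compact (K := univ) isCompact_univ).mono_set (subset_univ I)
  -- Integrating difference quotients of `H` and passing to the limit defines `ν` from the set
  -- alone, with no choice of endpoints; additivity is inherited from the integral.
  let ν : Set Torus → ℝ := fun I => limUnder atTop fun n => ∫ x in I, D n x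
  have hprim : ∀ b, Tendsto (fun n : ℕ => ((n : ℝ) + 1) * ∫ t in b..b + 1 / ((n : ℝ) + 1), G t)
      atTop (𝓝 (G b)) := by
    intro b
    have hder : HasDerivAt (fun x => ∫ t in b..x, G t) (G b) b :=
      intervalIntegral.integral_hasDerivAt_right (hGc.intervalIntegrable _ _)
        hGc.stronglyMeasurable.stronglyMeasurableAtFilter hGc.continuousAt
    have h1 := hder.tendsto_slope_zero_right
    have h2 : Tendsto (fun n : ℕ => 1 / ((n : ℝ) + 1)) atTop (𝓝[>] 0) :=
      tendsto_nhdsWithin_iff.2 ⟨tendsto_one_div_add_atTop_nhds_zero_nat,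
        Eventually.of_forall fun n => by simp only [mem_Ioi]; positivity⟩
    refine (h1.comp h2).congr fun n => ?_
    simp
  have hlim : ∀ (a b : ℝ) (J : Set ℝ), a ≤ b → b ≤ a + 1 →
      Ioo a b ⊆ J → J ⊆ Icc a b → Tendsto (fun n => ∫ x in proj J, D n x) atTop
        (𝓝 (G b - G a)) := by
    intro a b J hab hba h1 h2
    refine ((hprim b).sub (hprim a)).congr fun n => ?_
    rw [setIntegral_proj hab hba h1 h2]
    set d := 1 / ((n : ℝ) + 1)
    have h3 : ∀ t : ℝ, D n (t : Torus) = ((n : ℝ) + 1) * (G (t + d) - G t) := by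
      intro t
      simp only [D]
      rw [← AddCircle.coe_add, hH, hH]
    simp only [h3]
    have hi : ∀ u v : ℝ, IntervalIntegrable G volume u v := fun u v => hGc.intervalIntegrable _ _
    rw [intervalIntegral.integral_const_mul, intervalIntegral.integral_sub
      (Continuous.intervalIntegrable (by fun_prop) _ _) (hi _ _),
      intervalIntegral.integral_comp_add_right]
    have e1 := intervalIntegral.integral_add_adjacent_intervals (hi a (a + d)) (hi (a + d) (b + d))
    have e2 := intervalIntegral.integral_add_adjacent_intervals (hi a b) (hi b (b + d))
    rw [← mul_sub]
    congr 1
    linarith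
  have hval : ∀ (a b : ℝ) (J : Set ℝ), a ≤ b → b ≤ a + 1 →
      Ioo a b ⊆ J → J ⊆ Icc a b → ν (proj J) = G b - G a := fun a b J hab hba h1 h2 =>
    (hlim a b J hab hba h1 h2).limUnder_eq
  have hconv : ∀ I, IsArc I → Tendsto (fun n => ∫ x in I, D n x) atTop (𝓝 (ν I)) := by
    intro I hI
    obtain ⟨a, b, J, hab, hba, h1, h2, rfl⟩ := hI.exists_proj
    rw [hval a b J hab hba h1 h2]
    exact hlim a b J hab hba h1 h2
  have hmeas : ∀ I, IsArc I → MeasurableSet I := by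
    intro I hI
    obtain ⟨a, b, J, hab, hba, h1, h2, rfl⟩ := hI.exists_proj
    exact measurableSet_proj h1 h2
  refine ⟨ν, ⟨?_, ?_, ?_⟩, hval⟩
  · rw [← proj_Ico_univ 0, hval 0 (0 + 1) _ (by norm_num) le_rfl Ioo_subset_Ico_self
      Ico_subset_Icc_self, hG 0, sub_self]
  · intro I J hI hJ hIJ hdis
    refine tendsto_nhds_unique (hconv _ hIJ) (((hconv I hI).add (hconv J hJ)).congr fun n => ?_)
    rw [setIntegral_union (disjoint_iff_inter_eq_empty.2 hdis) (hmeas J hJ) (hDi n I) (hDi n J)]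
  · intro I hI hanti hempty
    have hlen : Tendsto (fun n => len (I n)) atTop (𝓝 0) := by
      have h := tendsto_measure_iInter_atTop (μ := (volume : Measure Torus))
        (fun n => (hmeas _ (hI n)).nullMeasurableSet) (antitone_nat_of_succ_le hanti)
        ⟨0, measure_ne_top _ _⟩
      rw [hempty, measure_empty] at h
      exact (ENNReal.tendsto_toReal ENNReal.zero_ne_top).comp h
    have huc : UniformContinuous H := CompactSpace.uniformContinuous_of_continuous hHc
    rw [Metric.tendsto_atTop]
    intro ε hε
    obtain ⟨δ, hδ, hδH⟩ := Metric.uniformContinuous_iff.1 huc ε hε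
    obtain ⟨N, hN⟩ := Metric.tendsto_atTop.1 hlen δ hδ
    refine ⟨N, fun n hn => ?_⟩
    have h := hN n hn
    obtain ⟨a, b, J, hab, hba, h1, h2, hJ⟩ := (hI n).exists_proj
    rw [hJ, len_proj hab hba h1 h2, Real.dist_eq, sub_zero] at h
    rw [hJ, hval a b J hab hba h1 h2, Real.dist_eq, sub_zero, ← hH, ← hH, ← Real.dist_eq]
    refine hδH (lt_of_le_of_lt ?_ h)
    rw [dist_eq_norm, ← AddCircle.coe_sub]
    exact QuotientAddGroup.norm_mk_le_norm

/-! ### Carleson sets and families of intervals -/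

instance : LocallyConnectedSpace Torus :=
  have : LocallyPathConnectedSpace Torus :=
    (QuotientAddGroup.isQuotientMap_mk (N := AddSubgroup.zmultiples (1 : ℝ))).locallyPathConnectedSpace
  inferInstance

instance : IsProbabilityMeasure (volume : Measure Torus) := ⟨UnitAddCircle.measure_univ⟩

theorem exists_Ioo_of_isOpen_isPreconnected {V : Set ℝ} (hV : IsOpen V) (hp : IsPreconnected V)
    (hne : V.Nonempty) {x y : ℝ} (hVxy : V ⊆ Ioo x y) :
    ∃ a b, x ≤ a ∧ a < b ∧ b ≤ y ∧ V = Ioo a b := by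
  have hb : BddBelow V := bddBelow_Ioo.mono hVxy
  have ha : BddAbove V := bddAbove_Ioo.mono hVxy
  have hsub : V ⊆ Ioo (sInf V) (sSup V) := by
    rw [← interior_Icc]
    exact interior_maximal (fun t ht => ⟨csInf_le hb ht, le_csSup ha ht⟩) hV
  obtain ⟨t, ht⟩ := hne
  refine ⟨sInf V, sSup V, le_csInf ⟨t, ht⟩ fun s hs => (hVxy hs).1.le,
    (hsub ht).1.trans (hsub ht).2, csSup_le ⟨t, ht⟩ fun s hs => (hVxy hs).2.le, ?_⟩
  exact hsub.antisymm (IsConnected.Ioo_csInf_csSup_subset ⟨⟨t, ht⟩, hp⟩ hb ha)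

theorem exists_Ioo_of_mem_complArcs {F : Set Torus} (hF : IsClosed F) {x : ℝ}
    (hx : (x : Torus) ∈ F) {I : Set Torus} (hI : I ∈ complArcs F) :
    ∃ a b, x ≤ a ∧ a < b ∧ b ≤ x + 1 ∧ I = proj (Ioo a b) := by
  obtain ⟨p, hp, rfl⟩ := hI
  have hopen : IsOpen (connectedComponentIn Fᶜ p) := hF.isOpen_compl.connectedComponentIn
  have hsub : connectedComponentIn Fᶜ p ⊆ Fᶜ := connectedComponentIn_subset _ _
  set I := connectedComponentIn Fᶜ p
  -- As `x` projects into `F`, every component lies in the circle minus that point, which is charted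
  -- by `(x, x + 1)`.
  let e := AddCircle.openPartialHomeomorphCoe (1 : ℝ) x
  have htarget : I ⊆ e.target := fun q hq h => hsub hq (by
    rw [mem_singleton_iff.1 h]; exact hx)
  have himage : e.symm '' I = e.source ∩ e ⁻¹' I := e.symm_image_eq_source_inter_preimage htarget
  have hV : IsOpen (e.symm '' I) := by
    rw [himage]
    exact e.isOpen_inter_preimage hopen
  have hVp : IsPreconnected (e.symm '' I) :=
    isPreconnected_connectedComponentIn.image _ (e.continuousOn_symm.mono htarget)
  have hVsub : e.symm '' I ⊆ Ioo x (x + 1) := by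
    rw [himage]; exact inter_subset_left
  obtain ⟨a, b, h1, h2, h3, h4⟩ := exists_Ioo_of_isOpen_isPreconnected hV hVp
    (Nonempty.image _ ⟨p, mem_connectedComponentIn hp⟩) hVsub
  refine ⟨a, b, h1, h2, h3, ?_⟩
  rw [← h4, proj, image_image]
  exact ((image_congr fun q hq => e.right_inv (htarget hq)).trans (image_id I)).symm

theorem pairwiseDisjoint_complArcs (F : Set Torus) : (complArcs F).PairwiseDisjoint id := by
  rintro _ ⟨p, hp, rfl⟩ _ ⟨q, hq, rfl⟩ hne
  rw [Function.onFun, Set.disjoint_left]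
  intro r hr hr'
  exact hne ((connectedComponentIn_eq hr).trans (connectedComponentIn_eq hr').symm)

theorem iUnion_complArcs (F : Set Torus) : ⋃ I : complArcs F, I.1 = Fᶜ := by
  refine Subset.antisymm (iUnion_subset ?_) fun p hp => ?_
  · rintro ⟨_, p, hp, rfl⟩
    exact connectedComponentIn_subset _ _
  · exact mem_iUnion.2 ⟨⟨_, p, hp, rfl⟩, mem_connectedComponentIn hp⟩

/-- The complementary arcs of a Carleson set as a family of intervals of the line. -/
theorem IsCarlesonSet.exists_intervals {Λ : ℝ → ℝ} (hΛ : ∀ t ∈ Ioc (0 : ℝ) 1, 0 < Λ t)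
    {F : Set Torus} (hF : IsCarlesonSet Λ F) :
    ∃ (x : ℝ) (p : complArcs F → ℝ × ℝ),
      (∀ i, x ≤ (p i).1 ∧ (p i).1 < (p i).2 ∧ (p i).2 ≤ x + 1 ∧
        i.1 = proj (Ioo (p i).1 (p i).2)) ∧
      (∀ i j, i ≠ j → (p i).2 ≤ (p j).1 ∨ (p j).2 ≤ (p i).1) ∧
      HasSum (fun i => (p i).2 - (p i).1) 1 ∧
      Summable (fun i => ((p i).2 - (p i).1) * Λ ((p i).2 - (p i).1)) := by
  obtain ⟨q, hq⟩ := hF.nonempty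
  obtain ⟨x, rfl⟩ := QuotientAddGroup.mk_surjective q
  have hex : ∀ i : complArcs F, ∃ p : ℝ × ℝ, x ≤ p.1 ∧ p.1 < p.2 ∧ p.2 ≤ x + 1 ∧
      i.1 = proj (Ioo p.1 p.2) := by
    intro i
    obtain ⟨a, b, h⟩ := exists_Ioo_of_mem_complArcs hF.closed hq i.2
    exact ⟨(a, b), h⟩
  choose p hp using hex
  have hlen : ∀ i : complArcs F, len i.1 = (p i).2 - (p i).1 := by
    intro i
    obtain ⟨h1, h2, h3, h4⟩ := hp i
    rw [h4, len_Ioo h2.le (by linarith)]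
  have hopen : ∀ i : complArcs F, IsOpen i.1 := fun i => by
    rw [(hp i).2.2.2]; exact isOpen_proj isOpen_Ioo
  have hcount : (complArcs F).Countable := by
    refine (pairwiseDisjoint_complArcs F).countable_of_isOpen (fun i hi => hopen ⟨i, hi⟩) ?_
    rintro _ ⟨r, hr, rfl⟩
    exact ⟨r, mem_connectedComponentIn hr⟩
  have : Countable (complArcs F) := hcount
  have hdis : ∀ i j : complArcs F, i ≠ j → Disjoint i.1 j.1 := fun i j hij =>
    pairwiseDisjoint_complArcs F i.2 j.2 fun h => hij (Subtype.ext h)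
  refine ⟨x, p, hp, ?_, ?_, ?_⟩
  · intro i j hij
    have hd := hdis i j hij
    rw [(hp i).2.2.2, (hp j).2.2.2] at hd
    by_contra! hlt
    obtain ⟨t, ht1, ht2⟩ := exists_between
      (max_lt (lt_min (hp i).2.1 hlt.2) (lt_min hlt.1 (hp j).2.1))
    exact Set.disjoint_left.1 hd
      ⟨t, ⟨(le_max_left _ _).trans_lt ht1, ht2.trans_le (min_le_left _ _)⟩, rfl⟩
      ⟨t, ⟨(le_max_right _ _).trans_lt ht1, ht2.trans_le (min_le_right _ _)⟩, rfl⟩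
  · have hvol : ∑' i : complArcs F, volume i.1 = 1 := by
      rw [← measure_iUnion (fun i j hij => hdis i j hij) fun i => (hopen i).measurableSet,
        iUnion_complArcs,
        prob_compl_eq_one_iff hF.closed.measurableSet]
      exact hF.null
    have h := ENNReal.hasSum_toReal (f := fun i : complArcs F => volume i.1) (by simp [hvol])
    rw [← ENNReal.tsum_toReal_eq fun i => measure_ne_top _ _, hvol] at h
    simpa [← hlen, len, measureReal_def] using h
  · have h := ENNReal.summable_toReal hF.entropy_lt_top.ne
    refine h.congr fun i => ?_
    obtain ⟨h1, h2, h3, -⟩ := hp i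
    rw [hlen i, ENNReal.toReal_ofReal]
    exact mul_nonneg (by linarith) (hΛ _ ⟨by linarith, by linarith⟩).le

/-- Summation over the complementary arcs of the complement of a disjoint union of intervals. -/
theorem hasSum_complArcs_iff {V : ℕ → Set Torus} (hV : ∀ n, IsOpen (V n))
    (hVp : ∀ n, IsPreconnected (V n)) (hVd : ∀ m n, m ≠ n → Disjoint (V m) (V n))
    {M : Type*} [AddCommMonoid M] [TopologicalSpace M] {g : Set Torus → M} (hg : g ∅ = 0) (s : M) :
    HasSum (fun I : complArcs (⋃ n, V n)ᶜ => g I.1) s ↔ HasSum (fun n => g (V n)) s := by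
  have hcomp : ∀ n, ∀ q ∈ V n, connectedComponentIn (⋃ n, V n)ᶜᶜ q = V n := by
    intro n q hq
    rw [compl_compl]
    refine Subset.antisymm ?_ ((hVp n).subset_connectedComponentIn hq (subset_iUnion V n))
    refine IsPreconnected.subset_left_of_subset_union (hV n)
      (isOpen_iUnion fun m : {m // m ≠ n} => hV m) ?_ ?_ ?_ isPreconnected_connectedComponentIn
    · exact disjoint_iUnion_right.2 fun m => hVd n m m.2.symm
    · refine (connectedComponentIn_subset _ _).trans (iUnion_subset fun m => ?_)
      by_cases hm : m = n
      · rw [hm]; exact subset_union_left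
      · exact (subset_iUnion (fun m : {m // m ≠ n} => V m) ⟨m, hm⟩).trans subset_union_right
    · exact ⟨q, mem_connectedComponentIn (mem_iUnion.2 ⟨n, hq⟩), hq⟩
  -- Empty `V n` are not components; they are harmless since `g ∅ = 0`.
  let S : Set ℕ := {n | (V n).Nonempty}
  have hmem : ∀ n ∈ S, V n ∈ complArcs (⋃ n, V n)ᶜ := fun n ⟨q, hq⟩ =>
    ⟨q, by rw [compl_compl]; exact mem_iUnion.2 ⟨n, hq⟩, (hcomp n q hq).symm⟩
  let φ : S → complArcs (⋃ n, V n)ᶜ := fun n => ⟨V n, hmem n n.2⟩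
  have hφ : Function.Bijective φ := by
    constructor
    · intro m n hmn
      by_contra hne
      have h1 : V m = V n := congrArg Subtype.val hmn
      have h2 := hVd m n fun h => hne (Subtype.ext h)
      rw [h1, disjoint_self] at h2
      exact n.2.ne_empty h2
    · rintro ⟨_, q, hq, rfl⟩
      rw [compl_compl] at hq
      obtain ⟨n, hn⟩ := mem_iUnion.1 hq
      exact ⟨⟨n, q, hn⟩, Subtype.ext (hcomp n q hn).symm⟩
  rw [← (Equiv.ofBijective φ hφ).hasSum_iff]
  refine (hasSum_subtype_iff_of_support_subset (f := fun n => g (V n)) (s := S) ?_)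
  intro n hn
  by_contra h
  exact hn (by simp only [S, mem_ofPred_eq, not_nonempty_iff_eq_empty] at h; simp [h, hg])

/-- Non-overlapping intervals of total length `1` and finite entropy are the complementary arcs of
a Carleson set. -/
theorem isCarlesonSet_of_intervals {Λ : ℝ → ℝ} {x : ℝ} {p : ℕ → ℝ × ℝ}
    (hp : ∀ n, x ≤ (p n).1 ∧ (p n).1 ≤ (p n).2 ∧ (p n).2 ≤ x + 1)
    (hd : ∀ m n, m ≠ n → (p m).2 ≤ (p n).1 ∨ (p n).2 ≤ (p m).1)
    (hlen : HasSum (fun n => (p n).2 - (p n).1) 1)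
    (hent : Summable fun n => ((p n).2 - (p n).1) * Λ ((p n).2 - (p n).1)) :
    IsCarlesonSet Λ (⋃ n, proj (Ioo (p n).1 (p n).2))ᶜ ∧
      ∀ g : Set Torus → ℝ, g ∅ = 0 → ∀ s,
        (HasSum (fun I : complArcs (⋃ n, proj (Ioo (p n).1 (p n).2))ᶜ => g I.1) s ↔
          HasSum (fun n => g (proj (Ioo (p n).1 (p n).2))) s) := by
  have hV : ∀ n, IsOpen (proj (Ioo (p n).1 (p n).2)) := fun n => isOpen_proj isOpen_Ioo
  have hVp : ∀ n, IsPreconnected (proj (Ioo (p n).1 (p n).2)) := fun n =>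
    isPreconnected_Ioo.image _ continuous_coe.continuousOn
  have hsub : ∀ n, Ioo (p n).1 (p n).2 ⊆ Ioo x (x + 1) := fun n =>
    Ioo_subset_Ioo (hp n).1 (hp n).2.2
  have hVd : ∀ m n, m ≠ n → Disjoint (proj (Ioo (p m).1 (p m).2)) (proj (Ioo (p n).1 (p n).2)) := by
    intro m n hmn
    rw [disjoint_iff_inter_eq_empty]
    refine proj_inter_eq_empty ((hsub m).trans Ioo_subset_Ico_self)
      ((hsub n).trans Ioo_subset_Ico_self) ?_
    ext t
    simp only [mem_inter_iff, mem_Ioo, mem_empty_iff_false, iff_false, not_and, not_lt, and_imp]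
    intro h1 h2 h3
    rcases hd m n hmn with h | h <;> linarith
  have hl : ∀ n, len (proj (Ioo (p n).1 (p n).2)) = (p n).2 - (p n).1 := fun n =>
    len_Ioo (hp n).2.1 (by linarith [(hp n).1, (hp n).2.2])
  refine ⟨⟨(isOpen_iUnion hV).isClosed_compl, ⟨(x : Torus), ?_⟩, ?_, ?_⟩, fun g hg s =>
    hasSum_complArcs_iff hV hVp hVd hg s⟩
  · simp only [mem_compl_iff, mem_iUnion, not_exists]
    rintro n ⟨t, ht, htx⟩
    have h1 := hsub n ht
    have := injOn_coe_Ico x (Ioo_subset_Ico_self h1) (left_mem_Ico.2 (by linarith)) htx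
    linarith [h1.1]
  · rw [prob_compl_eq_zero_iff (isOpen_iUnion hV).measurableSet,
      measure_iUnion (fun m n hmn => hVd m n hmn) fun n => (hV n).measurableSet]
    have h1 : ∀ n, volume (proj (Ioo (p n).1 (p n).2)) = ENNReal.ofReal ((p n).2 - (p n).1) :=
      fun n => volume_proj (by linarith [(hp n).1, (hp n).2.2]) le_rfl Ioo_subset_Icc_self
    simp only [h1]
    rw [← ENNReal.ofReal_tsum_of_nonneg (fun n => by linarith [(hp n).2.1]) hlen.summable,
      hlen.tsum_eq, ENNReal.ofReal_one]
  · have h1 := (hasSum_complArcs_iff hV hVp hVd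
      (g := fun I => ENNReal.ofReal (len I * Λ (len I))) (by simp [len])
      (∑' n, ENNReal.ofReal (len (proj (Ioo (p n).1 (p n).2)) *
        Λ (len (proj (Ioo (p n).1 (p n).2)))))).2 ENNReal.summable.hasSum
    rw [entropy, h1.tsum_eq]
    simp only [hl]
    exact hent.tsum_ofReal_lt_top

/-! ### Convergence and sign of the sums over complementary arcs -/

namespace IsMajorant

variable {Λ : ℝ → ℝ}

theorem mul_nonneg' (hΛ : IsMajorant Λ) {t : ℝ} (ht : t ∈ Icc (0 : ℝ) 1) : 0 ≤ t * Λ t := by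
  rcases ht.1.eq_or_lt with rfl | h
  · simp
  · exact (mul_pos h (hΛ.pos t ⟨h, ht.2⟩)).le

/-- Below `δ` use that `t * Λ t` increases, above `δ` that `Λ` decreases. The bound is affine in
`t`, so it can be summed over gaps knowing only their number and total length. -/
theorem mul_le_add (hΛ : IsMajorant Λ) {t δ : ℝ} (ht : t ∈ Icc (0 : ℝ) 1)
    (hδ : δ ∈ Ioc (0 : ℝ) 1) : t * Λ t ≤ δ * Λ δ + Λ δ * t := by
  rcases le_total t δ with h | h
  · have h1 : t * Λ t ≤ δ * Λ δ := hΛ.mul_monotone ht ⟨hδ.1.le, hδ.2⟩ h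
    have := mul_nonneg (hΛ.pos δ hδ).le ht.1
    linarith
  · have h1 := mul_le_mul_of_nonneg_left (hΛ.antitone hδ ⟨hδ.1.trans_le h, ht.2⟩ h) ht.1
    have := mul_pos hδ.1 (hΛ.pos δ hδ)
    linarith

end IsMajorant

/-- The increments of `f` over the finitely many intervals left over by a finite disjoint family. -/
theorem sub_sum_le_of_intervals {Λ f : ℝ → ℝ} {C δ x : ℝ} (hΛ : IsMajorant Λ) (hC : 0 ≤ C)
    (hfk : ∀ s t, s ≤ t → t ≤ s + 1 → f t - f s ≤ C * ((t - s) * Λ (t - s)))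
    (hδ : δ ∈ Ioc (0 : ℝ) 1) {ι : Type*} {p : ι → ℝ × ℝ}
    (hd : ∀ i j, i ≠ j → (p i).2 ≤ (p j).1 ∨ (p j).2 ≤ (p i).1) (S : Finset ι) (v : ℝ)
    (hxv : x ≤ v) (hvx : v ≤ x + 1) (hp : ∀ i ∈ S, x ≤ (p i).1 ∧ (p i).1 < (p i).2 ∧ (p i).2 ≤ v) :
    f v - f x - ∑ i ∈ S, (f (p i).2 - f (p i).1) ≤
      C * ((S.card + 1) * (δ * Λ δ) + Λ δ * (v - x - ∑ i ∈ S, ((p i).2 - (p i).1))) := by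
  classical
  have base : ∀ s t, s ≤ t → t ≤ s + 1 → f t - f s ≤ C * (δ * Λ δ + Λ δ * (t - s)) :=
    fun s t h1 h2 => (hfk s t h1 h2).trans (mul_le_mul_of_nonneg_left
      (hΛ.mul_le_add ⟨by linarith, by linarith⟩ hδ) hC)
  -- Removing the rightmost interval splits off the gap to its right.
  induction S using Finset.induction_on_max_value (fun i => (p i).1) generalizing v with
  | empty => simpa using base x v hxv hvx
  | insert i S hi hmax ih =>
    obtain ⟨h1, h2, h3⟩ := hp i (Finset.mem_insert_self _ _)
    have h4 := ih (p i).1 h1 (by linarith) fun j hj => by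
      obtain ⟨k1, k2, k3⟩ := hp j (Finset.mem_insert_of_mem hj)
      refine ⟨k1, k2, ?_⟩
      rcases hd j i (fun h => hi (h ▸ hj)) with h | h
      · exact h
      · have := hmax j hj
        linarith
    have h5 := base (p i).2 v h3 (by linarith)
    rw [Finset.sum_insert hi, Finset.sum_insert hi, Finset.card_insert_of_notMem hi]
    push_cast
    linarith

/-- Take `S` to be all arcs longer than a small `δ`. The total mass is zero, so minus the mass of
`S` is at most the positive mass of the at most `S.card + 1` gaps, which tail entropies control. -/
theorem exists_finset_neg_sum_le {Λ : ℝ → ℝ} {μ : Set Torus → ℝ} {C : ℝ} (hΛ : IsMajorant Λ)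
    (hμ : IsPremeasure μ) (hC : C ∈ boundConstants Λ μ) {F : Set Torus} (hF : IsCarlesonSet Λ F)
    (S₀ : Finset (complArcs F)) {η : ℝ} (hη : 0 < η) :
    ∃ S, S₀ ⊆ S ∧ -∑ I ∈ S, μ I.1 ≤ η := by
  classical
  obtain ⟨hC0, hCμ⟩ := hC
  obtain ⟨f, hf, hμf⟩ := hμ.exists_distribution
  obtain ⟨x, p, hp, hd, hlen, hent⟩ := hF.exists_intervals hΛ.pos
  have hfk : ∀ s t, s ≤ t → t ≤ s + 1 → f t - f s ≤ C * ((t - s) * Λ (t - s)) := by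
    intro s t hst hts
    rw [← hμf s t hst hts, ← len_Ico hst hts]
    exact hCμ _ (isArc_Ico hst hts)
  have hatom : ∀ a, μ (proj {a}) ≤ 0 := fun a => by
    have h := hCμ _ (isArc_singleton a)
    have h0 : len (proj {a}) = 0 := by
      have := len_proj (le_refl a) (by linarith) (J := {a}) (by simp) (by simp)
      simpa using this
    rw [h0] at h; simpa using h
  -- Atoms have nonpositive mass, so passing from a half-open to an open arc can only increase `μ`.
  have hμI : ∀ i : complArcs F, f (p i).2 - f (p i).1 ≤ μ i.1 := by
    intro i
    obtain ⟨h1, h2, h3, h4⟩ := hp i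
    have h5 := hμ.singleton_add_Ioo h2 (by linarith)
    rw [hμf _ _ h2.le (by linarith), ← h4] at h5
    linarith [hatom (p i).1]
  let κ : complArcs F → ℝ := fun i => ((p i).2 - (p i).1) * Λ ((p i).2 - (p i).1)
  have hmem : ∀ i, (p i).2 - (p i).1 ∈ Ioc (0 : ℝ) 1 := fun i => by
    obtain ⟨h1, h2, h3, -⟩ := hp i
    exact ⟨by linarith, by linarith⟩
  have hκ0 : ∀ i, 0 ≤ κ i := fun i => hΛ.mul_nonneg' (Ioc_subset_Icc_self (hmem i))
  have hη' : 0 < η / (3 * C) := by positivity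
  set η' := η / (3 * C)
  obtain ⟨S₁', hS₁'⟩ := summable_iff_vanishing_norm.1 hent η' hη'
  let S₁ := S₀ ∪ S₁'
  have hS₁ : ∀ T, Disjoint T S₁ → ∑ i ∈ T, κ i ≤ η' := fun T hT =>
    (le_abs_self _).trans (hS₁' T (hT.mono_right Finset.subset_union_right)).le
  -- choice of the scale `δ`
  have hev1 : ∀ᶠ δ in 𝓝[>] (0 : ℝ), ∀ i ∈ S₁, δ < (p i).2 - (p i).1 :=
    (Filter.eventually_all_finset S₁).2 fun i _ =>
      nhdsWithin_le_nhds (eventually_lt_nhds (hmem i).1)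
  have hev2 : ∀ᶠ δ in 𝓝[>] (0 : ℝ), (S₁.card + 1) * (δ * Λ δ) < η' := by
    have := hΛ.mul_tendsto_zero.const_mul ((S₁.card : ℝ) + 1)
    rw [mul_zero] at this
    exact this.eventually (gt_mem_nhds hη')
  have hev3 : ∀ᶠ δ in 𝓝[>] (0 : ℝ), δ ∈ Ioc (0 : ℝ) 1 := Ioc_mem_nhdsGT one_pos
  obtain ⟨δ, ⟨hδ1, hδ2⟩, hδ⟩ := ((hev1.and hev2).and hev3).exists
  have hΛδ := hΛ.pos δ hδ
  have hfin : {i | δ < (p i).2 - (p i).1}.Finite := by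
    have h := hlen.summable.tendsto_cofinite_zero.eventually (gt_mem_nhds hδ.1)
    refine (Filter.eventually_cofinite.1 h).subset fun i hi => ?_
    exact not_lt.2 (le_of_lt hi)
  let S := hfin.toFinset
  have hS : ∀ i, i ∈ S ↔ δ < (p i).2 - (p i).1 := fun i => by simp [S]
  have hS₁S : S₁ ⊆ S := fun i hi => (hS i).2 (hδ1 i hi)
  refine ⟨S, Finset.subset_union_left.trans hS₁S, ?_⟩
  -- Each arc of `S` outside `S₁` has entropy at least `δ * Λ δ`, so their number is controlled by
  -- the tail; `S₁` was fixed before `δ`.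
  have hcard : (S.card + 1) * (δ * Λ δ) ≤ 2 * η' := by
    have h1 : ((S \ S₁).card : ℝ) * (δ * Λ δ) ≤ η' := by
      refine le_trans ?_ (hS₁ (S \ S₁) Finset.sdiff_disjoint)
      rw [← nsmul_eq_mul]
      refine Finset.card_nsmul_le_sum _ _ _ fun i hi => ?_
      exact hΛ.mul_monotone ⟨hδ.1.le, hδ.2⟩ (Ioc_subset_Icc_self (hmem i))
        ((hS i).1 (Finset.mem_sdiff.1 hi).1).le
    have h2 : (S.card : ℝ) = (S \ S₁).card + S₁.card := by
      rw [← Nat.cast_add, Finset.card_sdiff_add_card_eq_card hS₁S]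
    rw [h2]
    linarith
  -- The remaining length comes from arcs of length at most `δ`, where `Λ` is at least `Λ δ`; it too
  -- is paid by the tail entropy.
  have hrest : Λ δ * (1 - ∑ i ∈ S, ((p i).2 - (p i).1)) ≤ η' := by
    have hlim : Tendsto (fun T : Finset (complArcs F) => Λ δ * (∑ i ∈ T, ((p i).2 - (p i).1) -
        ∑ i ∈ S, ((p i).2 - (p i).1))) atTop
        (𝓝 (Λ δ * (1 - ∑ i ∈ S, ((p i).2 - (p i).1)))) := (hlen.sub_const _).const_mul _
    refine le_of_tendsto hlim ?_
    filter_upwards [eventually_ge_atTop S] with T hT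
    rw [← Finset.sum_sdiff hT, add_sub_cancel_right, Finset.mul_sum]
    refine le_trans (Finset.sum_le_sum fun i hi => ?_)
      (hS₁ (T \ S) (Finset.sdiff_disjoint.mono_right hS₁S))
    have hi' : (p i).2 - (p i).1 ≤ δ := not_lt.1 fun h => (Finset.mem_sdiff.1 hi).2 ((hS i).2 h)
    rw [mul_comm]
    exact mul_le_mul_of_nonneg_left (hΛ.antitone (hmem i) hδ hi') (hmem i).1.le
  have hmain := sub_sum_le_of_intervals hΛ hC0.le hfk hδ hd S (x + 1) (by linarith) le_rfl
    fun i _ => ⟨(hp i).1, (hp i).2.1, (hp i).2.2.1⟩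
  rw [hf x, sub_self, zero_sub, add_sub_cancel_left] at hmain
  have hsum := Finset.sum_le_sum fun i (_ : i ∈ S) => hμI i
  have h3 : C * (3 * η') = η := by simp only [η']; field_simp
  have h4 := mul_le_mul_of_nonneg_left (add_le_add hcard hrest) hC0.le
  linarith

/-- The defects `C * (t * Λ t) - μ I`, with `t` the length of `I`, are nonnegative. By
`exists_finset_neg_sum_le` every finite set of arcs enlarges to one whose defect sum is at most the
total entropy times `C`, plus `1`. -/
theorem summable_complArcs {Λ : ℝ → ℝ} {μ : Set Torus → ℝ} (hΛ : IsMajorant Λ)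
    (hμ : IsBddPremeasure Λ μ) {F : Set Torus} (hF : IsCarlesonSet Λ F) :
    Summable fun I : complArcs F => μ I.1 := by
  obtain ⟨x, p, hp, -, -, hent⟩ := hF.exists_intervals hΛ.pos
  obtain ⟨hμ, C, hC⟩ := hμ
  have hle : ∀ i : complArcs F, 0 ≤ C * (((p i).2 - (p i).1) * Λ ((p i).2 - (p i).1)) - μ i.1 := by
    intro i
    obtain ⟨h1, h2, h3, h4⟩ := hp i
    have := hC.2 (proj (Ioo (p i).1 (p i).2)) (isArc_Ioo h2.le (by linarith))
    rw [len_Ioo h2.le (by linarith), ← h4] at this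
    linarith
  have hsum : Summable fun i : complArcs F =>
      C * (((p i).2 - (p i).1) * Λ ((p i).2 - (p i).1)) - μ i.1 := by
    refine summable_of_sum_le hle (c := (∑' i : complArcs F,
      C * (((p i).2 - (p i).1) * Λ ((p i).2 - (p i).1))) + 1) fun S₀ => ?_
    obtain ⟨S, hS, hS1⟩ := exists_finset_neg_sum_le hΛ hμ hC hF S₀ one_pos
    refine (Finset.sum_le_sum_of_subset_of_nonneg hS fun i _ _ => hle i).trans ?_
    rw [Finset.sum_sub_distrib]
    have := (hent.mul_left C).sum_le_tsum S fun i _ => mul_nonneg hC.1.le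
      (hΛ.mul_nonneg' ⟨by linarith [(hp i).2.1], by linarith [(hp i).1, (hp i).2.2.1]⟩)
    linarith
  refine ((hent.mul_left C).sub hsum).congr fun i => ?_
  ring

theorem tsum_complArcs_nonneg {Λ : ℝ → ℝ} {μ : Set Torus → ℝ} (hΛ : IsMajorant Λ)
    (hμ : IsBddPremeasure Λ μ) {F : Set Torus} (hF : IsCarlesonSet Λ F) :
    0 ≤ ∑' I : complArcs F, μ I.1 := by
  have hs := summable_complArcs hΛ hμ hF
  obtain ⟨hμ, C, hC⟩ := hμ
  by_contra! hneg
  obtain ⟨S₀, hS₀⟩ := Filter.eventually_atTop.1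
    (hs.hasSum.eventually (gt_mem_nhds (show _ < (∑' I : complArcs F, μ I.1) / 2 by linarith)))
  obtain ⟨S, hS, hS1⟩ := exists_finset_neg_sum_le hΛ hμ hC hF S₀
    (η := -(∑' I : complArcs F, μ I.1) / 2) (by linarith)
  have : ∑ I ∈ S, μ I.1 < (∑' I : complArcs F, μ I.1) / 2 := hS₀ S hS
  linarith

/-! ### Absolute continuity kills the singular part -/

theorem IsPremeasure.add {μ ν : Set Torus → ℝ} (hμ : IsPremeasure μ) (hν : IsPremeasure ν) :
    IsPremeasure (μ + ν) where
  univ := by simp [hμ.univ, hν.univ]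
  union I J hI hJ hIJ h := by
    simp only [Pi.add_apply, hμ.union I J hI hJ hIJ h, hν.union I J hI hJ hIJ h]; ring
  tendsto I h1 h2 h3 := by simpa using (hμ.tendsto I h1 h2 h3).add (hν.tendsto I h1 h2 h3)

theorem IsBddPremeasure.add {Λ : ℝ → ℝ} {μ ν : Set Torus → ℝ} (hμ : IsBddPremeasure Λ μ)
    (hν : IsBddPremeasure Λ ν) : IsBddPremeasure Λ (μ + ν) := by
  obtain ⟨hμ, C, hC, hCμ⟩ := hμ
  obtain ⟨hν, D, hD, hDν⟩ := hν
  refine ⟨hμ.add hν, C + D, by positivity, fun I hI => ?_⟩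
  rw [add_mul]
  exact add_le_add (hCμ I hI) (hDν I hI)

theorem singularPart_eq_zero_of_isAbsCont {Λ : ℝ → ℝ} {μ : Set Torus → ℝ} (hΛ : IsMajorant Λ)
    (hμ : IsBddPremeasure Λ μ) (hac : IsAbsCont Λ μ) {F : Set Torus} (hF : IsCarlesonSet Λ F) :
    singularPart μ F = 0 := by
  classical
  obtain ⟨ν, hν, ⟨B, hB⟩, hlim⟩ := hac
  have hμ0 := tsum_complArcs_nonneg hΛ hμ hF
  obtain ⟨x, p, hp, -, -, hent⟩ := hF.exists_intervals hΛ.pos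
  let κ : complArcs F → ℝ := fun i => ((p i).2 - (p i).1) * Λ ((p i).2 - (p i).1)
  have hlen : ∀ i : complArcs F, len i.1 = (p i).2 - (p i).1 := fun i => by
    obtain ⟨h1, h2, h3, h4⟩ := hp i
    rw [h4, len_Ioo h2.le (by linarith)]
  have harc : ∀ i : complArcs F, IsArc i.1 := fun i => by
    obtain ⟨h1, h2, h3, h4⟩ := hp i
    rw [h4]; exact isArc_Ioo h2.le (by linarith)
  have hκ0 : ∀ i, 0 ≤ κ i := fun i => hΛ.mul_nonneg'
    ⟨by linarith [(hp i).2.1], by linarith [(hp i).1, (hp i).2.2.1]⟩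
  have hbound : ∀ n, ∀ i : complArcs F, (μ + ν n) i.1 ≤ (B + 1) * κ i := by
    intro n i
    -- The infimum `bddNorm` need not be known to be attained, so one unit of room is left to pick
    -- an actual constant.
    have h1 : bddNorm Λ (μ + ν n) < B + 1 := by
      linarith [hB (mem_range_self (f := fun n => bddNorm Λ (μ + ν n)) n)]
    obtain ⟨C, ⟨hC0, hC⟩, hCB⟩ := exists_lt_of_csInf_lt (hμ.add (hν n)).2 h1
    have h2 := hC i.1 (harc i)
    rw [hlen i] at h2
    exact h2.trans (mul_le_mul_of_nonneg_right hCB.le (hκ0 i))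
  have hB1 : 0 < B + 1 := by
    have h1 := hB (mem_range_self (f := fun n => bddNorm Λ (μ + ν n)) 0)
    have h2 : 0 ≤ bddNorm Λ (μ + ν 0) := Real.sInf_nonneg fun C hC => hC.1.le
    linarith [show bddNorm Λ (μ + ν 0) ≤ B from h1]
  have hle : ∑' I : complArcs F, μ I.1 ≤ 0 := by
    refine le_of_forall_pos_le_add fun η hη => ?_
    rw [zero_add]
    have hη1 : 0 < η / (2 * (B + 1)) := by positivity
    -- The uniform norm bound handles the arcs outside `S` for all `n` at once; `n` is then chosen
    -- so that uniform smallness handles the finitely many arcs of `S`.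
    obtain ⟨S, hS⟩ := summable_iff_vanishing_norm.1 hent _ hη1
    have hη2 : 0 < η / (2 * (S.card + 1)) := by positivity
    obtain ⟨n, hn⟩ := (hlim.eventually (gt_mem_nhds (ENNReal.ofReal_pos.2 hη2))).exists
    have hsmall : ∀ i : complArcs F, (μ + ν n) i.1 ≤ η / (2 * (S.card + 1)) := by
      intro i
      have h1 := (le_iSup (fun I : {I : Set Torus // IsArc I} => ‖(μ + ν n) I.1‖ₑ)
        ⟨i.1, harc i⟩).trans hn.le
      rw [← ofReal_norm, ENNReal.ofReal_le_ofReal_iff hη2.le] at h1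
      exact (le_abs_self _).trans h1
    have hsum := (summable_complArcs hΛ hμ hF).add (summable_complArcs hΛ (hν n) hF)
    have h1 : ∑' I : complArcs F, (μ I.1 + ν n I.1) ≤ η := by
      refine le_of_tendsto hsum.hasSum ?_
      filter_upwards [eventually_ge_atTop S] with T hT
      rw [← Finset.sum_sdiff hT]
      have h2 : ∑ i ∈ S, (μ i.1 + ν n i.1) ≤ η / 2 := by
        refine (Finset.sum_le_card_nsmul S _ _ fun i _ => hsmall i).trans ?_
        rw [nsmul_eq_mul, mul_div_assoc', div_le_div_iff₀ (by positivity) two_pos]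
        nlinarith
      have h3 : ∑ i ∈ T \ S, (μ i.1 + ν n i.1) ≤ η / 2 := by
        refine (Finset.sum_le_sum fun i _ => hbound n i).trans ?_
        rw [← Finset.mul_sum]
        have h4 := ((le_abs_self _).trans_lt (hS (T \ S) Finset.sdiff_disjoint)).le
        refine (mul_le_mul_of_nonneg_left h4 hB1.le).trans_eq ?_
        field_simp
      linarith
    rw [(summable_complArcs hΛ hμ hF).tsum_add (summable_complArcs hΛ (hν n) hF)] at h1
    linarith [tsum_complArcs_nonneg hΛ (hν n) hF]
  rw [singularPart, le_antisymm hle hμ0, neg_zero]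

/-! ### Vanishing singular part implies absolute continuity -/

/-- The function `t * Λ t`, extended from `[0, 1]` to the line by constants. -/
def gauge (Λ : ℝ → ℝ) (t : ℝ) : ℝ := max 0 (min t 1) * Λ (max 0 (min t 1))

theorem clamp_mem (t : ℝ) : max 0 (min t 1) ∈ Icc (0 : ℝ) 1 :=
  ⟨le_max_left _ _, max_le zero_le_one (min_le_right _ _)⟩

theorem gauge_of_mem {Λ : ℝ → ℝ} {t : ℝ} (ht : t ∈ Icc (0 : ℝ) 1) : gauge Λ t = t * Λ t := by
  rw [gauge, min_eq_left ht.2, max_eq_right ht.1]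

namespace IsMajorant

variable {Λ : ℝ → ℝ}

theorem continuous_gauge (hΛ : IsMajorant Λ) : Continuous (gauge Λ) :=
  hΛ.mul_continuous.comp_continuous (f := fun t : ℝ => max 0 (min t 1)) (by fun_prop) clamp_mem

theorem monotone_gauge (hΛ : IsMajorant Λ) : Monotone (gauge Λ) := fun _ _ h =>
  hΛ.mul_monotone (clamp_mem _) (clamp_mem _) (max_le_max le_rfl (min_le_min h le_rfl))

theorem gauge_one_pos (hΛ : IsMajorant Λ) : 0 < gauge Λ 1 := by
  rw [gauge_of_mem (by simp), one_mul]
  exact hΛ.pos 1 (by simp)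

theorem mul_gauge_one_le (hΛ : IsMajorant Λ) (t : ℝ) (ht : t ∈ Icc (0 : ℝ) 1) :
    t * gauge Λ 1 ≤ gauge Λ t := by
  rw [gauge_of_mem (by simp), gauge_of_mem ht, one_mul]
  rcases ht.1.eq_or_lt with rfl | h
  · simp
  · exact mul_le_mul_of_nonneg_left (hΛ.antitone ⟨h, ht.2⟩ (by simp) ht.2) h.le

theorem exists_mul_le_gauge (hΛ : IsMajorant Λ) (T : ℝ) :
    ∃ δ > 0, ∀ t ∈ Icc (0 : ℝ) δ, T * t ≤ gauge Λ t := by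
  have h1 := hΛ.tendsto_top.eventually_ge_atTop T
  have h2 : ∀ᶠ δ in 𝓝[>] (0 : ℝ), δ ∈ Ioc (0 : ℝ) 1 := Ioc_mem_nhdsGT one_pos
  obtain ⟨δ, hT, hδ⟩ := (h1.and h2).exists
  refine ⟨δ, hδ.1, fun t ht => ?_⟩
  rw [gauge_of_mem ⟨ht.1, ht.2.trans hδ.2⟩, mul_comm]
  rcases ht.1.eq_or_lt with rfl | h
  · simp
  · exact mul_le_mul_of_nonneg_left
      (hT.trans (hΛ.antitone ⟨h, ht.2.trans hδ.2⟩ hδ ht.2)) ht.1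

end IsMajorant

/-- If all singular parts vanish, the arcs complementary to non-overlapping intervals of full
length carry no mass. -/
theorem hasSum_zero_of_singularPart {Λ : ℝ → ℝ} {μ : Set Torus → ℝ} (hΛ : IsMajorant Λ)
    (hμ : IsBddPremeasure Λ μ) (hs : ∀ F, IsCarlesonSet Λ F → singularPart μ F = 0)
    {x : ℝ} {p : ℕ → ℝ × ℝ} (hp : ∀ n, x ≤ (p n).1 ∧ (p n).1 ≤ (p n).2 ∧ (p n).2 ≤ x + 1)
    (hd : ∀ m n, m ≠ n → (p m).2 ≤ (p n).1 ∨ (p n).2 ≤ (p m).1)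
    (hlen : HasSum (fun n => (p n).2 - (p n).1) 1)
    (hent : Summable fun n => ((p n).2 - (p n).1) * Λ ((p n).2 - (p n).1)) :
    HasSum (fun n => μ (proj (Ioo (p n).1 (p n).2))) 0 := by
  obtain ⟨hF, hiff⟩ := isCarlesonSet_of_intervals hp hd hlen hent
  rw [← hiff μ hμ.1.empty]
  have h := (summable_complArcs hΛ hμ hF).hasSum
  have h0 := hs _ hF
  rw [singularPart, neg_eq_zero] at h0
  rwa [h0] at h

/-- A point is itself a Carleson set, with a single complementary arc of length `1`; the circle has
mass zero. -/
theorem singleton_eq_zero_of_singularPart {Λ : ℝ → ℝ} {μ : Set Torus → ℝ} (hΛ : IsMajorant Λ)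
    (hμ : IsBddPremeasure Λ μ) (hs : ∀ F, IsCarlesonSet Λ F → singularPart μ F = 0) (a : ℝ) :
    μ (proj {a}) = 0 := by
  let p : ℕ → ℝ × ℝ := fun n => if n = 0 then (a, a + 1) else (a, a)
  have hp0 : p 0 = (a, a + 1) := rfl
  have hpn : ∀ n, n ≠ 0 → p n = (a, a) := fun n hn => if_neg hn
  have h := hasSum_zero_of_singularPart hΛ hμ hs (x := a) (p := p) ?_ ?_ ?_ ?_
  · have h1 := hasSum_single (f := fun n => μ (proj (Ioo (p n).1 (p n).2))) 0
      fun n hn => by simp [hpn n hn, hμ.1.empty]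
    have h2 := h1.unique h
    have h3 := hμ.1.singleton_add_Ioo (a := a) (b := a + 1) (by linarith) le_rfl
    rw [proj_Ico_univ, hμ.1.univ] at h3
    simp only [hp0] at h2
    linarith
  · intro n
    by_cases hn : n = 0
    · simp [hn, hp0]
    · simp [hpn n hn]
  · intro m n hmn
    by_cases hn : n = 0
    · left; simp [hn, hp0, hpn m (by rintro rfl; exact hmn hn.symm)]
    · right
      by_cases hm : m = 0
      · simp [hm, hp0, hpn n hn]
      · simp [hpn m hm, hpn n hn]
  · have := hasSum_single (f := fun n => (p n).2 - (p n).1) 0 fun n hn => by simp [hpn n hn]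
    simpa [hp0] using this
  · refine summable_of_ne_finset_zero (s := {0}) fun n hn => ?_
    simp [hpn n (by simpa using hn)]

/-- The distribution function of a `Λ`-bounded premeasure without atoms is continuous. -/
theorem continuous_distribution {μ : Set Torus → ℝ} (hμ : IsPremeasure μ)
    (hatom : ∀ a, μ (proj {a}) = 0) {f k : ℝ → ℝ} (hkc : Continuous k) (hkm : Monotone k)
    (hk0 : k 0 = 0) {C : ℝ} (hC : 0 ≤ C)
    (hμf : ∀ s t, s ≤ t → t ≤ s + 1 → μ (proj (Ico s t)) = f t - f s)
    (hfk : ∀ s t, s ≤ t → t ≤ s + 1 → f t - f s ≤ C * k (t - s)) : Continuous f := by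
  rw [continuous_iff_continuousAt]
  intro s
  have hd : ∀ n : ℕ, 0 < 1 / ((n : ℝ) + 1) ∧ 1 / ((n : ℝ) + 1) ≤ 1 := fun n =>
    ⟨by positivity, by rw [div_le_one (by positivity)]; linarith [n.cast_nonneg (α := ℝ)]⟩
  have hanti : ∀ n : ℕ, 1 / (((n + 1 : ℕ) : ℝ) + 1) ≤ 1 / ((n : ℝ) + 1) := fun n =>
    one_div_le_one_div_of_le (by positivity) (by push_cast; linarith)
  have hz : Tendsto (fun n : ℕ => 1 / ((n : ℝ) + 1)) atTop (𝓝 0) :=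
    tendsto_one_div_add_atTop_nhds_zero_nat
  -- values along sequences converging to `s` from both sides
  have hright : Tendsto (fun n : ℕ => f (s + 1 / ((n : ℝ) + 1)) - f s) atTop (𝓝 0) := by
    refine (hμ.tendsto (fun n => proj (Ioo s (s + 1 / ((n : ℝ) + 1))))
      (fun n => isArc_Ioo (by linarith [(hd n).1]) (by linarith [(hd n).2]))
      (fun n => image_mono (Ioo_subset_Ioo_right (by linarith [hanti n]))) ?_).congr fun n => ?_
    · rw [eq_empty_iff_forall_notMem]
      intro q hq
      rw [mem_iInter] at hq
      obtain ⟨t, ht, rfl⟩ := hq 0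
      have hts : 0 < t - s := by linarith [ht.1]
      obtain ⟨n, hn⟩ := (hz.eventually (gt_mem_nhds hts)).exists
      obtain ⟨t', ht', htt⟩ := hq n
      have h1 : ∀ n : ℕ, Ioo s (s + 1 / ((n : ℝ) + 1)) ⊆ Ico s (s + 1) := fun n =>
        Ioo_subset_Ico_self.trans (Ico_subset_Ico_right (by linarith [(hd n).2]))
      have := injOn_coe_Ico s (h1 n ht') (h1 0 ht) htt
      linarith [ht'.2]
    · have h1 := hμ.singleton_add_Ioo (a := s) (b := s + 1 / ((n : ℝ) + 1))
        (by linarith [(hd n).1]) (by linarith [(hd n).2])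
      rw [hatom, zero_add, hμf _ _ (by linarith [(hd n).1]) (by linarith [(hd n).2])] at h1
      exact h1
  have hleft : Tendsto (fun n : ℕ => f s - f (s - 1 / ((n : ℝ) + 1))) atTop (𝓝 0) := by
    refine (hμ.tendsto (fun n => proj (Ico (s - 1 / ((n : ℝ) + 1)) s))
      (fun n => isArc_Ico (by linarith [(hd n).1]) (by linarith [(hd n).2]))
      (fun n => image_mono (Ico_subset_Ico_left (by linarith [hanti n]))) ?_).congr fun n => ?_
    · rw [eq_empty_iff_forall_notMem]
      intro q hq
      rw [mem_iInter] at hq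
      obtain ⟨t, ht, rfl⟩ := hq 0
      have hts : 0 < s - t := by linarith [ht.2]
      obtain ⟨n, hn⟩ := (hz.eventually (gt_mem_nhds hts)).exists
      obtain ⟨t', ht', htt⟩ := hq n
      have h1 : ∀ n : ℕ, Ico (s - 1 / ((n : ℝ) + 1)) s ⊆ Ico (s - 1) (s - 1 + 1) := fun n =>
        Ico_subset_Ico (by linarith [(hd n).2]) (by linarith)
      have := injOn_coe_Ico (s - 1) (h1 n ht') (h1 0 ht) htt
      linarith [ht'.1]
    · exact hμf _ _ (by linarith [(hd n).1]) (by linarith [(hd n).2])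
  have hk : Tendsto (fun n : ℕ => C * k (1 / ((n : ℝ) + 1))) atTop (𝓝 0) := by
    have := ((hkc.tendsto 0).comp hz).const_mul C
    rwa [hk0, mul_zero] at this
  rw [Metric.continuousAt_iff]
  intro ε hε
  have hε2 : 0 < ε / 2 := by positivity
  obtain ⟨n, ⟨h1, h2⟩, h3⟩ := (((Metric.tendsto_nhds.1 hright _ hε2).and
    (Metric.tendsto_nhds.1 hleft _ hε2)).and (Metric.tendsto_nhds.1 hk _ hε2)).exists
  rw [Real.dist_eq, sub_zero, abs_lt] at h1 h2 h3
  obtain ⟨hd0, hd1⟩ := hd n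
  set d := 1 / ((n : ℝ) + 1)
  refine ⟨d, hd0, fun {t} ht => ?_⟩
  rw [Real.dist_eq, abs_lt] at ht
  have hkd : ∀ r, r ≤ d → C * k r < ε / 2 := fun r hr =>
    (mul_le_mul_of_nonneg_left (hkm hr) hC).trans_lt h3.2
  rw [Real.dist_eq, abs_lt]
  -- Only upward growth of `f` is bounded by `k`. The opposite bound comes from comparing with `s +
  -- d` or `s - d`, where `f` is already close to `f s`.
  rcases le_total s t with hst | hts
  · have e1 := hfk s t hst (by linarith)
    have e2 := hfk t (s + d) (by linarith) (by linarith)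
    have e3 := hkd (t - s) (by linarith)
    have e4 := hkd (s + d - t) (by linarith)
    constructor <;> linarith
  · have e1 := hfk t s hts (by linarith)
    have e2 := hfk (s - d) t (by linarith) (by linarith)
    have e3 := hkd (s - t) (by linarith)
    have e4 := hkd (t - (s - d)) (by linarith)
    constructor <;> linarith

theorem isAbsCont_of_singularPart {Λ : ℝ → ℝ} {μ : Set Torus → ℝ} (hΛ : IsMajorant Λ)
    (hμ : IsBddPremeasure Λ μ) (hs : ∀ F, IsCarlesonSet Λ F → singularPart μ F = 0) :
    IsAbsCont Λ μ := by
  have hatom := singleton_eq_zero_of_singularPart hΛ hμ hs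
  have hnull := @hasSum_zero_of_singularPart Λ μ hΛ hμ hs
  obtain ⟨hμ, C, hC, hCμ⟩ := hμ
  obtain ⟨f, hf, hμf⟩ := hμ.exists_distribution
  have hk0 : gauge Λ 0 = 0 := by rw [gauge_of_mem (by simp), zero_mul]
  have hfk : ∀ s t, s ≤ t → t ≤ s + 1 → f t - f s ≤ C * gauge Λ (t - s) := by
    intro s t hst hts
    rw [← hμf s t hst hts, gauge_of_mem ⟨by linarith, by linarith⟩, ← len_Ico hst hts]
    exact hCμ _ (isArc_Ico hst hts)
  have hfc := continuous_distribution hμ hatom hΛ.continuous_gauge hΛ.monotone_gauge hk0 hC.le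
    hμf hfk
  have hval : ∀ {a b : ℝ}, a ≤ b → b ≤ a + 1 → _ := hμ.arc_eq hf hμf hatom
  have hex : ∀ n : ℕ, ∃ ν : Set Torus → ℝ, IsBddPremeasure Λ ν ∧
      2 * C ∈ boundConstants Λ (μ + ν) ∧ ∀ I, IsArc I → |(μ + ν) I| ≤ 1 / ((n : ℝ) + 1) := by
    intro n
    have hε : 0 < 1 / ((n : ℝ) + 1) := by positivity
    obtain ⟨K, hK, hchain⟩ := exists_chain_cost_ge hΛ.continuous_gauge hΛ.monotone_gauge hk0
      hΛ.mul_gauge_one_le hΛ.gauge_one_pos hΛ.exists_mul_le_gauge hfc hf hC hfk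
      (fun x p hp hd hlen hent => by
        have hle : ∀ n, (p n).2 ≤ (p n).1 + 1 := fun n => by linarith [(hp n).1, (hp n).2.2]
        refine (hnull hp hd hlen (hent.congr fun n => gauge_of_mem
          ⟨by linarith [(hp n).2.1], by linarith [hle n]⟩)).congr_fun ?_
        exact fun n => (hval (hp n).2.1 (hle n)).2.2.2.symm) hε
    obtain ⟨G, hG, hGc, hG1, hG2, hG3⟩ := exists_decomposition_of_chain_cost
      hΛ.continuous_gauge hΛ.monotone_gauge hk0 hf hC hfk hK hchain
    -- With `-G` as distribution function of `ν`, that of `μ + ν` is `f - G`; its growth constant `2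
    -- * C` does not depend on `n`, while the constant `K` of `ν` may.
    obtain ⟨ν, hν, hνG⟩ := exists_premeasure (G := fun t => -G t) (fun t => by simp [hG t]) hGc.neg
    have key : ∀ I, IsArc I → ∃ a b, a ≤ b ∧ b ≤ a + 1 ∧ len I = b - a ∧ μ I = f b - f a ∧
        ν I = G a - G b := by
      rintro I ⟨a, b, hab, hba, hI⟩
      refine ⟨a, b, hab, hba, ?_⟩
      obtain ⟨v1, v2, v3, v4⟩ := hval hab hba
      have hJ : ∀ J : Set ℝ, Ioo a b ⊆ J → J ⊆ Icc a b →
          len (proj J) = b - a ∧ ν (proj J) = G a - G b := fun J h1 h2 =>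
        ⟨len_proj hab hba h1 h2, (hνG a b J hab hba h1 h2).trans (by ring)⟩
      rcases hI with rfl | rfl | rfl | rfl
      · obtain ⟨h1, h2⟩ := hJ _ Ioo_subset_Icc_self le_rfl
        exact ⟨h1, v1, h2⟩
      · obtain ⟨h1, h2⟩ := hJ _ Ioo_subset_Ico_self Ico_subset_Icc_self
        exact ⟨h1, v2, h2⟩
      · obtain ⟨h1, h2⟩ := hJ _ Ioo_subset_Ioc_self Ioc_subset_Icc_self
        exact ⟨h1, v3, h2⟩
      · obtain ⟨h1, h2⟩ := hJ _ le_rfl Ioo_subset_Icc_self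
        exact ⟨h1, v4, h2⟩
    refine ⟨ν, ⟨hν, K, hC.trans_le hK, fun I hI => ?_⟩, ⟨by positivity, fun I hI => ?_⟩,
      fun I hI => ?_⟩
    · obtain ⟨a, b, hab, hba, hI0, -, hI2⟩ := key I hI
      rw [← gauge_of_mem (len_mem_Icc I), hI0, hI2]
      exact hG2 a b hab hba
    · obtain ⟨a, b, hab, hba, hI0, hI1, hI2⟩ := key I hI
      have := hG1 a b hab hba
      rw [Pi.add_apply, ← gauge_of_mem (len_mem_Icc I), hI0, hI1, hI2]
      linarith
    · obtain ⟨a, b, hab, hba, hI0, hI1, hI2⟩ := key I hI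
      rw [Pi.add_apply, hI1, hI2]
      convert hG3 a b using 2
      ring
  choose ν hν hbd hsmall using hex
  refine ⟨ν, hν, ⟨2 * C, ?_⟩, ?_⟩
  · rintro _ ⟨n, rfl⟩
    exact csInf_le ⟨0, fun c hc => hc.1.le⟩ (hbd n)
  · have hz : Tendsto (fun n : ℕ => ENNReal.ofReal (1 / ((n : ℝ) + 1))) atTop (𝓝 0) := by
      have := ENNReal.tendsto_ofReal (tendsto_one_div_add_atTop_nhds_zero_nat (𝕜 := ℝ))
      rwa [ENNReal.ofReal_zero] at this
    refine tendsto_of_tendsto_of_tendsto_of_le_of_le tendsto_const_nhds hz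
      (fun n => zero_le) fun n => ?_
    refine iSup_le fun I => ?_
    rw [← ofReal_norm]
    exact ENNReal.ofReal_le_ofReal (hsmall n I.1 I.2)

end LambdaPremeasure

end

theorem theorem2p1 (Λ : ℝ → ℝ) (hΛ : LambdaPremeasure.IsMajorant Λ)
    (μ : Set LambdaPremeasure.Torus → ℝ) (hμ : LambdaPremeasure.IsBddPremeasure Λ μ) :
    (∀ F, LambdaPremeasure.IsCarlesonSet Λ F →
      Summable fun I : LambdaPremeasure.complArcs F => μ I.1) ∧
    (LambdaPremeasure.IsAbsCont Λ μ ↔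
      ∀ F, LambdaPremeasure.IsCarlesonSet Λ F → LambdaPremeasure.singularPart μ F = 0) :=
  ⟨fun _ hF => LambdaPremeasure.summable_complArcs hΛ hμ hF,
    fun hac _ hF => LambdaPremeasure.singularPart_eq_zero_of_isAbsCont hΛ hμ hac hF,
    LambdaPremeasure.isAbsCont_of_singularPart hΛ hμ⟩
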